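/- Let $M$ be a smooth connected manifold of dimension $n$ (Hausdorff, second countable, without boundary), let $\Delta$ be a smooth distribution of rank $m$ on $M$, let $g$ be a smooth Riemannian metric on $\Delta$, and fix $\bar x\in M$. A horizontal path from $x_0$ to $x_1$ is an absolutely continuous curve $\gamma:[0,1]\to M$ with $\gamma(0)=x_0$, $\gamma(1)=x_1$ and $\dot\gamma(t)\in\Delta(\gamma(t))$ for almost every $t$. For $x\in M$ put $$V_{g,\Delta}(x)=\inf\left\{\int_0^1 g_{\gamma(t)}(\dot\gamma(t),\dot\gamma(t))\,dt \ :\ \gamma \text{ a horizontal path from } \bar x \text{ to } x\right\},$$ and for $x\in M$, $p\in T_x^*M$ put $$H_{g,\Delta}(x,p)=\max_{v\in\Delta(x)}\left(p(v)-\tfrac12 g_x(v,v)\right).$$ **Proposition.** Suppose that $\Delta$ is nonholonomic: every point of $M$ has a neighborhood $\mathcal V$ on which $\Delta$ is spanned by $m$ linearly independent smooth vector fields $f_1,\dots,f_m$ such that the Lie algebra generated by $f_1,\dots,f_m$ takes the value $T_yM$ at every $y\in\mathcal V$. Then $V_{g,\Delta}(x)$ is finite for every $x\in M$, the function $V_{g,\Delta}:M\to\mathbb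 R$ is continuous, and it is a viscosity solution on $M\setminus\{\bar x\}$ of $$-\tfrac12 V_{g,\Delta}(x)+H_{g,\Delta}\left(x,\tfrac12\,dV_{g,\Delta}(x)\right)=0 .$$ The latter means that, with $U=M\setminus\{\bar x\}$, for every $x_0\in U$ and every $C^1$ function $\phi:U\to\mathbb R$ with $\phi(x_0)=V_{g,\Delta}(x_0)$ the following holds: if $\phi\ge V_{g,\Delta}$ on $U$, then $-\tfrac12 V_{g,\Delta}(x_0)+H_{g,\Delta}(x_0,\tfrac12 d\phi(x_0))\le 0$; if $\phi\le V_{g,\Delta}$ on $U$, then $-\tfrac12 V_{g,\Delta}(x_0)+H_{g,\Delta}(x_0,\tfrac12 d\phi(x_0))\ge 0$. No assumption is made on singular minimizing paths, and completeness of $M$ for the sub-Riemannian distance is not required. -/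

import Mathlib

open Set MeasureTheory
open scoped Manifold ContDiff ENNReal

noncomputable section

namespace SubRiemannian

/-- The vector field `X` (defined on all of `M`, with arbitrary values off `U`) is smooth on `U`. -/
def SmoothVectorFieldOn {n : ℕ} {M : Type*} [TopologicalSpace M]
    [ChartedSpace (EuclideanSpace ℝ (Fin n)) M] [IsManifold (𝓡 n) ∞ M]
    (X : ∀ y : M, TangentSpace (𝓡 n) y) (U : Set M) : Prop :=
  ContMDiffOn (𝓡 n) (𝓡 n).tangent ∞ (fun y => (⟨y, X y⟩ : TangentBundle (𝓡 n) M)) U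

/-- The `m`-tuple `f` of vector fields represents the family of subspaces `D` on `U`: the fields
are smooth on `U`, linearly independent at every point of `U`, and span `D y` for all `y ∈ U`. -/
structure Represents {n m : ℕ} {M : Type*} [TopologicalSpace M]
    [ChartedSpace (EuclideanSpace ℝ (Fin n)) M] [IsManifold (𝓡 n) ∞ M]
    (f : Fin m → ∀ y : M, TangentSpace (𝓡 n) y)
    (D : ∀ y : M, Submodule ℝ (TangentSpace (𝓡 n) y)) (U : Set M) : Prop where
  smooth : ∀ i, SmoothVectorFieldOn (f i) U
  linearIndependent : ∀ y ∈ U, LinearIndependent ℝ (fun i => f i y)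
  span_eq : ∀ y ∈ U, D y = Submodule.span ℝ (range fun i => f i y)

/-- A smooth distribution of rank `m` on the `n`-dimensional manifold `M`. -/
structure Distribution (n m : ℕ) (M : Type*) [TopologicalSpace M]
    [ChartedSpace (EuclideanSpace ℝ (Fin n)) M] [IsManifold (𝓡 n) ∞ M] where
  /-- the subspace `Δ(x)` of `T_x M` -/
  fiber : ∀ x : M, Submodule ℝ (TangentSpace (𝓡 n) x)
  exists_represents : ∀ x : M, ∃ U : Set M, IsOpen U ∧ x ∈ U ∧
    ∃ f : Fin m → ∀ y : M, TangentSpace (𝓡 n) y, Represents f fiber U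

/-- Membership in the Lie algebra of vector fields generated by the fields `f i`. If the `f i` are
smooth on an open set `U`, so are its members, and their values on `U` depend only on the
restrictions of the `f i` to `U`. -/
inductive MemLieAlgebra {n m : ℕ} {M : Type*} [TopologicalSpace M]
    [ChartedSpace (EuclideanSpace ℝ (Fin n)) M]
    (f : Fin m → ∀ y : M, TangentSpace (𝓡 n) y) : (∀ y : M, TangentSpace (𝓡 n) y) → Prop
  | of (i : Fin m) : MemLieAlgebra f (f i)
  | zero : MemLieAlgebra f 0
  | add {X Y : ∀ y : M, TangentSpace (𝓡 n) y} :
      MemLieAlgebra f X → MemLieAlgebra f Y → MemLieAlgebra f (X + Y)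
  | smul (c : ℝ) {X : ∀ y : M, TangentSpace (𝓡 n) y} :
      MemLieAlgebra f X → MemLieAlgebra f (c • X)
  | bracket {X Y : ∀ y : M, TangentSpace (𝓡 n) y} :
      MemLieAlgebra f X → MemLieAlgebra f Y →
        MemLieAlgebra f (VectorField.mlieBracket (𝓡 n) X Y)

/-- `Δ` is nonholonomic: near every point it is represented by a tuple of smooth vector fields
that satisfies Hörmander's condition. -/
def Distribution.IsNonholonomic {n m : ℕ} {M : Type*} [TopologicalSpace M]
    [ChartedSpace (EuclideanSpace ℝ (Fin n)) M] [IsManifold (𝓡 n) ∞ M]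
    (Δ : Distribution n m M) : Prop :=
  ∀ x : M, ∃ U : Set M, IsOpen U ∧ x ∈ U ∧
    ∃ f : Fin m → ∀ y : M, TangentSpace (𝓡 n) y, Represents f Δ.fiber U ∧
      ∀ y ∈ U, ∀ v : TangentSpace (𝓡 n) y, ∃ X, MemLieAlgebra f X ∧ X y = v

/-- A smooth Riemannian metric on the distribution `Δ`: an inner product on every `Δ(x)`, such
that `x ↦ g_x(X(x), Y(x))` is smooth for all smooth local sections `X`, `Y` of `Δ`. -/
structure Metric {n m : ℕ} {M : Type*} [TopologicalSpace M]
    [ChartedSpace (EuclideanSpace ℝ (Fin n)) M] [IsManifold (𝓡 n) ∞ M]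
    (Δ : Distribution n m M) where
  /-- the inner product `g_x` on `Δ(x)` -/
  form : ∀ x : M, LinearMap.BilinForm ℝ (Δ.fiber x)
  symm : ∀ x (v w : Δ.fiber x), form x v w = form x w v
  pos : ∀ x (v : Δ.fiber x), v ≠ 0 → 0 < form x v v
  smooth : ∀ U : Set M, IsOpen U → ∀ X Y : ∀ y : M, Δ.fiber y,
    SmoothVectorFieldOn (fun y => (X y : TangentSpace (𝓡 n) y)) U →
    SmoothVectorFieldOn (fun y => (Y y : TangentSpace (𝓡 n) y)) U →
    ContMDiffOn (𝓡 n) 𝓘(ℝ, ℝ) ∞ (fun y => form y (X y) (Y y)) U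

/-- The curve `γ : [0,1] → M` (a function on `ℝ` of which only the restriction to `[0,1]` is
used) is absolutely continuous: it is continuous, and absolutely continuous in charts. -/
def IsAbsolutelyContinuous {n : ℕ} {M : Type*} [TopologicalSpace M]
    [ChartedSpace (EuclideanSpace ℝ (Fin n)) M] (γ : ℝ → M) : Prop :=
  ContinuousOn γ (Icc 0 1) ∧
    ∀ (z : M) (a b : ℝ), 0 ≤ a → a ≤ b → b ≤ 1 →
      MapsTo γ (Icc a b) (chartAt (EuclideanSpace ℝ (Fin n)) z).source →
      AbsolutelyContinuousOnInterval
        (fun t => chartAt (EuclideanSpace ℝ (Fin n)) z (γ t)) a b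

/-- The velocity `γ'(t)`; absolutely continuous curves have one for almost every `t`. -/
def velocity {n : ℕ} {M : Type*} [TopologicalSpace M]
    [ChartedSpace (EuclideanSpace ℝ (Fin n)) M] (γ : ℝ → M) (t : ℝ) :
    TangentSpace (𝓡 n) (γ t) :=
  mfderiv 𝓘(ℝ, ℝ) (𝓡 n) γ t (1 : ℝ)

/-- `γ : [0,1] → M` is a horizontal path joining `x₀` to `x₁`. -/
structure IsHorizontalPath {n m : ℕ} {M : Type*} [TopologicalSpace M]
    [ChartedSpace (EuclideanSpace ℝ (Fin n)) M] [IsManifold (𝓡 n) ∞ M]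
    (Δ : Distribution n m M) (x₀ x₁ : M) (γ : ℝ → M) : Prop where
  absolutelyContinuous : IsAbsolutelyContinuous (n := n) γ
  source : γ 0 = x₀
  target : γ 1 = x₁
  horizontal : ∀ᵐ t ∂(volume.restrict (Icc (0 : ℝ) 1)), velocity γ t ∈ Δ.fiber (γ t)

/-- The running cost `L_g(x, v) = g_x(v, v)` for `v ∈ Δ(x)`; its value is `+∞` for other `v`. -/
def Metric.cost {n m : ℕ} {M : Type*} [TopologicalSpace M]
    [ChartedSpace (EuclideanSpace ℝ (Fin n)) M] [IsManifold (𝓡 n) ∞ M]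
    {Δ : Distribution n m M} (g : Metric Δ) (x : M) (v : TangentSpace (𝓡 n) x) : ℝ≥0∞ :=
  ⨅ h : v ∈ Δ.fiber x, ENNReal.ofReal (g.form x ⟨v, h⟩ ⟨v, h⟩)

/-- The energy `J_g(γ) = ∫₀¹ L_g(γ(t), γ'(t)) dt` of a horizontal path, in `[0, +∞]`. -/
def Metric.energy {n m : ℕ} {M : Type*} [TopologicalSpace M]
    [ChartedSpace (EuclideanSpace ℝ (Fin n)) M] [IsManifold (𝓡 n) ∞ M]
    {Δ : Distribution n m M} (g : Metric Δ) (γ : ℝ → M) : ℝ≥0∞ :=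
  ∫⁻ t in Icc (0 : ℝ) 1, g.cost (γ t) (velocity γ t)

/-- The infimum of the energies of the horizontal paths joining `xbar` to `x`, in `[0, +∞]`. -/
def Metric.eValue {n m : ℕ} {M : Type*} [TopologicalSpace M]
    [ChartedSpace (EuclideanSpace ℝ (Fin n)) M] [IsManifold (𝓡 n) ∞ M]
    {Δ : Distribution n m M} (g : Metric Δ) (xbar x : M) : ℝ≥0∞ :=
  ⨅ (γ : ℝ → M) (_ : IsHorizontalPath Δ xbar x γ), g.energy γ

/-- The value function `V_{g,Δ}` as a real-valued function. -/
def Metric.value {n m : ℕ} {M : Type*} [TopologicalSpace M]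
    [ChartedSpace (EuclideanSpace ℝ (Fin n)) M] [IsManifold (𝓡 n) ∞ M]
    {Δ : Distribution n m M} (g : Metric Δ) (xbar x : M) : ℝ :=
  (g.eValue xbar x).toReal

/-- The Hamiltonian `H_{g,Δ}(x, p) = max_{v ∈ Δ(x)} (p(v) - g_x(v, v) / 2)`; see
`Metric.isGreatest_hamiltonian` for the fact that the supremum is a maximum. -/
def Metric.hamiltonian {n m : ℕ} {M : Type*} [TopologicalSpace M]
    [ChartedSpace (EuclideanSpace ℝ (Fin n)) M] [IsManifold (𝓡 n) ∞ M]
    {Δ : Distribution n m M} (g : Metric Δ) (x : M)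
    (p : TangentSpace (𝓡 n) x →L[ℝ] ℝ) : ℝ :=
  ⨆ v : Δ.fiber x, (p v - 1 / 2 * g.form x v v)

theorem Metric.isGreatest_hamiltonian {n m : ℕ} {M : Type*} [TopologicalSpace M]
    [ChartedSpace (EuclideanSpace ℝ (Fin n)) M] [IsManifold (𝓡 n) ∞ M]
    {Δ : Distribution n m M} (g : Metric Δ) (x : M)
    (p : TangentSpace (𝓡 n) x →L[ℝ] ℝ) :
    IsGreatest (range fun v : Δ.fiber x => p v - 1 / 2 * g.form x v v) (g.hamiltonian x p) := by
  have : FiniteDimensional ℝ (TangentSpace (𝓡 n) x) :=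
    inferInstanceAs (FiniteDimensional ℝ (EuclideanSpace ℝ (Fin n)))
  have inj : Function.Injective (g.form x) := by
    rw [← LinearMap.ker_eq_bot, LinearMap.ker_eq_bot']
    intro v hv
    by_contra hne
    have := g.pos x v hne
    rw [hv] at this
    simp at this
  have surj : Function.Surjective (g.form x) :=
    (LinearMap.injective_iff_surjective_of_finrank_eq_finrank
      (Subspace.dual_finrank_eq (K := ℝ) (V := Δ.fiber x)).symm).1 inj
  obtain ⟨w, hw⟩ := surj (p.toLinearMap.comp (Δ.fiber x).subtype)
  have hp : ∀ v : Δ.fiber x, p v = g.form x w v := fun v => by rw [hw]; rfl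
  have key : IsGreatest (range fun v : Δ.fiber x => p v - 1 / 2 * g.form x v v)
      (p w - 1 / 2 * g.form x w w) := by
    refine ⟨⟨w, rfl⟩, ?_⟩
    rintro _ ⟨v, rfl⟩
    have h0 : 0 ≤ g.form x (v - w) (v - w) := by
      by_cases h : v - w = 0
      · rw [h]; simp
      · exact (g.pos x _ h).le
    simp only [map_sub, LinearMap.sub_apply] at h0
    have := g.symm x v w
    simp only [hp]
    linarith
  have : g.hamiltonian x p = p w - 1 / 2 * g.form x w w := key.csSup_eq
  rwa [this]

/-- The differential of a real-valued function, as a covector. -/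
def differential {n : ℕ} {M : Type*} [TopologicalSpace M]
    [ChartedSpace (EuclideanSpace ℝ (Fin n)) M] (φ : M → ℝ) (x : M) :
    TangentSpace (𝓡 n) x →L[ℝ] ℝ :=
  mfderiv (𝓡 n) 𝓘(ℝ, ℝ) φ x

/-- `u` is a viscosity subsolution of `F(x, du(x), u(x)) = 0` on the open set `U`. -/
def IsViscositySubsolution {n : ℕ} {M : Type*} [TopologicalSpace M]
    [ChartedSpace (EuclideanSpace ℝ (Fin n)) M]
    (F : ∀ x : M, (TangentSpace (𝓡 n) x →L[ℝ] ℝ) → ℝ → ℝ) (u : M → ℝ) (U : Set M) : Prop :=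
  ContinuousOn u U ∧
    ∀ φ : M → ℝ, ContMDiffOn (𝓡 n) 𝓘(ℝ, ℝ) 1 φ U → (∀ x ∈ U, u x ≤ φ x) →
      ∀ x₀ ∈ U, φ x₀ = u x₀ → F x₀ (differential φ x₀) (u x₀) ≤ 0

/-- `u` is a viscosity supersolution of `F(x, du(x), u(x)) = 0` on the open set `U`. -/
def IsViscositySupersolution {n : ℕ} {M : Type*} [TopologicalSpace M]
    [ChartedSpace (EuclideanSpace ℝ (Fin n)) M]
    (F : ∀ x : M, (TangentSpace (𝓡 n) x →L[ℝ] ℝ) → ℝ → ℝ) (u : M → ℝ) (U : Set M) : Prop :=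
  ContinuousOn u U ∧
    ∀ ψ : M → ℝ, ContMDiffOn (𝓡 n) 𝓘(ℝ, ℝ) 1 ψ U → (∀ x ∈ U, ψ x ≤ u x) →
      ∀ x₀ ∈ U, ψ x₀ = u x₀ → 0 ≤ F x₀ (differential ψ x₀) (u x₀)

/-- `u` is a viscosity solution of `F(x, du(x), u(x)) = 0` on the open set `U`. -/
def IsViscositySolution {n : ℕ} {M : Type*} [TopologicalSpace M]
    [ChartedSpace (EuclideanSpace ℝ (Fin n)) M]
    (F : ∀ x : M, (TangentSpace (𝓡 n) x →L[ℝ] ℝ) → ℝ → ℝ) (u : M → ℝ) (U : Set M) : Prop :=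
  IsViscositySubsolution F u U ∧ IsViscositySupersolution F u U

end SubRiemannian

end

/-!
The value function is finite, continuous and a viscosity solution of its Hamilton–Jacobi equation.
The proof uses no minimizing path, so that neither completeness nor any assumption on singular
curves enters.

*The energy as a distance.* Reparametrizing and concatenating paths gives
`V(x, z) < A / s + B / (1 - s)` whenever `V(x, y) < A`, `V(y, z) < B` and `0 < s < 1`
(`Metric.eValue_triangle`), and `V(x, y) = V(y, x)` (`Metric.eValue_comm`). Everything else comes
from short paths.

*Short paths.* Read in a chart, a smooth section of `Δ` is a smooth vector field on an open subset
of `ℝⁿ`. Its flow is smooth in the initial point and the time together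
(`exists_smooth_local_flow`): after rescaling time, the integral equation on `C([0, 1], ℝⁿ)` is
solved by the inverse function theorem, because composition with a smooth map is smooth on spaces
of continuous functions (`contDiff_superposition`). Following the flow for time `τ` costs an energy
`O(τ²)` (`Metric.exists_horizontal_flow`).

*Controllability.* Composing flows of sections of `Δ` gives smooth families of horizontal motions
whose energy is as small as desired (`Metric.Steerable`). Suppose that the endpoints of the motions
issued from `x₀` form an immersed submanifold of dimension `k < n`. If all generating fields were
tangent to it near a point, they would lift to smooth fields on the parameter space
(`exists_smooth_lift`), and so would their brackets, the brackets of the lifts being related to them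
(`MemLieAlgebra.exists_smooth_lift`); by nonholonomicity the submanifold would have dimension `n`.
Hence some field is transverse to it at points arbitrarily close to the given one, and composing
with its flow raises `k` by one (`Metric.Steerable.succ`). A family with `k = n` reaches from `x₀`
an open set, into which the motion with the central parameter moves all points near `x₀`; since
paths can be reversed, these points are reached from `x₀` with small energy
(`Metric.eventually_eValue_lt`). Finiteness follows as `M` is connected, and continuity follows
from the triangle inequality.

*Subsolution.* Following a section of `Δ` backwards from `x₀` and returning, the triangle inequality
with `s = 1 - h` gives `dφ(v) - g(v, v) ≤ V(x₀)` for `v ∈ Δ(x₀)`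
(`Metric.differential_sub_form_le_value`); the left side is twice the function of which the
Hamiltonian at `dφ / 2` is the maximum.

*Supersolution.* The last piece, of duration `h`, of a path from `xbar` to `x₀` whose energy is
within `h²` of the infimum stays near `x₀`, and along it the test function grows by at most its
energy plus `h` times nearly `2 H(x₀, dψ / 2)`, by the fundamental theorem of calculus and the upper
semicontinuity of the Hamiltonian (`Metric.exists_nhds_sub_le`). Rescaling the first piece to
`[0, 1]` then bounds `V(x₀)` (`Metric.value_le_hamiltonian`).
-/

open Filter Topology
open scoped NNReal

noncomputable section

namespace SubRiemannian

/-! ### Absolutely continuous functions of a real variable -/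

/-- Reparametrization by a Lipschitz map preserves absolute continuity as soon as the map is
monotone or antitone: only then do disjoint intervals go to disjoint intervals. -/
theorem absolutelyContinuousOnInterval_comp {X : Type*} [PseudoMetricSpace X] {f : ℝ → X}
    {a b c d : ℝ} (hf : AbsolutelyContinuousOnInterval f a b) {h : ℝ → ℝ} {K : ℝ≥0}
    (hK : LipschitzWith K h) (hmono : Monotone h ∨ Antitone h)
    (hmaps : MapsTo h (uIcc c d) (uIcc a b)) :
    AbsolutelyContinuousOnInterval (fun t => f (h t)) c d := by
  rw [absolutelyContinuousOnInterval_iff] at hf ⊢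
  intro ε hε
  obtain ⟨δ, hδ, H⟩ := hf ε hε
  refine ⟨δ / (K + 1), by positivity, fun E hE hlen => ?_⟩
  refine H (E.1, fun i => (h (E.2 i).1, h (E.2 i).2)) ⟨fun i hi => ?_, ?_⟩ ?_
  · exact ⟨hmaps (hE.1 i hi).1, hmaps (hE.1 i hi).2⟩
  · intro i hi j hj hij
    have := hE.2 hi hj hij
    simp only [Function.onFun, uIoc, Ioc_disjoint_Ioc] at this ⊢
    rcases hmono with hm | hm
    · simp only [← hm.map_max, ← hm.map_min]
      exact hm this
    · simp only [← hm.map_max, ← hm.map_min]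
      exact hm this
  · calc ∑ i ∈ Finset.range E.1, dist (h (E.2 i).1) (h (E.2 i).2)
        ≤ ∑ i ∈ Finset.range E.1, K * dist (E.2 i).1 (E.2 i).2 :=
          Finset.sum_le_sum fun i _ => hK.dist_le_mul _ _
      _ = K * ∑ i ∈ Finset.range E.1, dist (E.2 i).1 (E.2 i).2 := by rw [Finset.mul_sum]
      _ ≤ K * (δ / (K + 1)) := by gcongr
      _ < (K + 1) * (δ / (K + 1)) := by gcongr; linarith
      _ = δ := by field_simp

theorem absolutelyContinuousOnInterval_union {F : Type*} [NormedAddCommGroup F] [NormedSpace ℝ F]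
    {f : ℝ → F}
    {a b c : ℝ} (hab : a ≤ b) (hbc : b ≤ c) (h₁ : AbsolutelyContinuousOnInterval f a b)
    (h₂ : AbsolutelyContinuousOnInterval f b c) : AbsolutelyContinuousOnInterval f a c := by
  have lmin : LipschitzWith 1 (fun t : ℝ => min t b) := LipschitzWith.id.min_const b
  have lmax : LipschitzWith 1 (fun t : ℝ => max t b) := LipschitzWith.id.max_const b
  have h₁' := absolutelyContinuousOnInterval_comp (c := a) (d := c) h₁ lmin
    (Or.inl fun x y hxy => min_le_min_right b hxy) (by
      intro t ht
      rw [uIcc_of_le (hab.trans hbc)] at ht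
      rw [uIcc_of_le hab]
      exact ⟨le_min ht.1 hab, min_le_right _ _⟩)
  have h₂' := absolutelyContinuousOnInterval_comp (c := a) (d := c) h₂ lmax
    (Or.inl fun x y hxy => max_le_max_right b hxy) (by
      intro t ht
      rw [uIcc_of_le (hab.trans hbc)] at ht
      rw [uIcc_of_le hbc]
      exact ⟨le_max_right _ _, max_le ht.2 hbc⟩)
  have hconst : AbsolutelyContinuousOnInterval (fun _ : ℝ => f b) a c :=
    ((LipschitzWith.const (f b)).lipschitzOnWith (s := uIcc a c)).absolutelyContinuousOnInterval
  convert (h₁'.add h₂').sub hconst using 1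
  funext t
  rcases le_total t b with h | h
  · simp [h]
  · simp [h]

theorem absolutelyContinuousOnInterval_lipschitz_comp {X Y : Type*} [PseudoMetricSpace X]
    [PseudoMetricSpace Y] {f : ℝ → X} {a b : ℝ} (hf : AbsolutelyContinuousOnInterval f a b)
    {φ : X → Y} {K : ℝ≥0} {s : Set X} (hφ : LipschitzOnWith K φ s) (hs : MapsTo f (uIcc a b) s) :
    AbsolutelyContinuousOnInterval (fun t => φ (f t)) a b := by
  rw [absolutelyContinuousOnInterval_iff] at hf ⊢
  intro ε hε
  obtain ⟨δ, hδ, H⟩ := hf (ε / (K + 1)) (by positivity)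
  refine ⟨δ, hδ, fun E hE hlen => ?_⟩
  calc ∑ i ∈ Finset.range E.1, dist (φ (f (E.2 i).1)) (φ (f (E.2 i).2))
      ≤ ∑ i ∈ Finset.range E.1, K * dist (f (E.2 i).1) (f (E.2 i).2) :=
        Finset.sum_le_sum fun i hi =>
          hφ.dist_le_mul _ (hs (hE.1 i hi).1) _ (hs (hE.1 i hi).2)
    _ = K * ∑ i ∈ Finset.range E.1, dist (f (E.2 i).1) (f (E.2 i).2) := by rw [Finset.mul_sum]
    _ ≤ K * (ε / (K + 1)) := by gcongr; exact (H E hE hlen).le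
    _ < (K + 1) * (ε / (K + 1)) := by gcongr; linarith
    _ = ε := by field_simp

theorem ae_differentiableAt_of_absolutelyContinuousOnInterval {n : ℕ}
    {f : ℝ → EuclideanSpace ℝ (Fin n)} {a b : ℝ} (hf : AbsolutelyContinuousOnInterval f a b) :
    ∀ᵐ t, t ∈ uIcc a b → DifferentiableAt ℝ f t :=
  hf.boundedVariationOn.ae_differentiableAt_of_mem_uIcc

/-! ### Smoothness of superposition operators -/

section Superposition

variable {K : Type} [TopologicalSpace K] [CompactSpace K]

/-- The superposition operator `u ↦ X ∘ u` on continuous functions. -/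
def superposition {E F : Type} [TopologicalSpace E] [TopologicalSpace F] (X : C(E, F)) :
    C(K, E) → C(K, F) := fun u => X.comp u

/-- Pointwise application of operator-valued continuous functions, as an operator between spaces
of continuous functions. -/
def pointwiseApply (K : Type) [TopologicalSpace K] [CompactSpace K]
    (E F : Type) [NormedAddCommGroup E] [NormedSpace ℝ E] [NormedAddCommGroup F]
    [NormedSpace ℝ F] : C(K, E →L[ℝ] F) →L[ℝ] C(K, E) →L[ℝ] C(K, F) :=
  LinearMap.mkContinuous₂
    (LinearMap.mk₂ ℝ (fun (A : C(K, E →L[ℝ] F)) (u : C(K, E)) =>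
        (⟨fun k => A k (u k), A.continuous.clm_apply u.continuous⟩ : C(K, F)))
      (fun A B u => by ext k; simp) (fun c A u => by ext k; simp)
      (fun A u v => by ext k; simp) (fun c A u => by ext k; simp)) 1 (by
    intro A u
    rw [ContinuousMap.norm_le _ (by positivity)]
    intro k
    calc ‖A k (u k)‖ ≤ ‖A k‖ * ‖u k‖ := (A k).le_opNorm _
      _ ≤ 1 * ‖A‖ * ‖u‖ := by
        rw [one_mul]
        gcongr
        · exact A.norm_coe_le_norm k
        · exact u.norm_coe_le_norm k)

@[simp]
theorem pointwiseApply_apply {E F : Type} [NormedAddCommGroup E] [NormedSpace ℝ E]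
    [NormedAddCommGroup F] [NormedSpace ℝ F] (A : C(K, E →L[ℝ] F)) (u : C(K, E)) (k : K) :
    pointwiseApply K E F A u k = A k (u k) := rfl

/-- The derivative of the superposition operator by `X` at `u` is multiplication by `DX ∘ u`: the
mean value inequality applies uniformly near the compact range of `u`. -/
theorem hasFDerivAt_superposition {E F : Type} [NormedAddCommGroup E] [NormedSpace ℝ E]
    [NormedAddCommGroup F] [NormedSpace ℝ F] (X : C(E, F)) (X' : C(E, E →L[ℝ] F))
    (hX : ∀ x, HasFDerivAt X (X' x) x) (u : C(K, E)) :
    HasFDerivAt (superposition (K := K) X) (pointwiseApply K E F (superposition X' u)) u := by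
  rw [hasFDerivAt_iff_isLittleO_nhds_zero, Asymptotics.isLittleO_iff]
  intro ε hε
  have hc : IsCompact (range u) := isCompact_range u.continuous
  have := hc.uniformContinuousAt_of_continuousAt X' (fun a _ => X'.continuous.continuousAt)
    (Metric.dist_mem_uniformity hε)
  obtain ⟨δ, hδ, hδ'⟩ := Metric.mem_uniformity_dist.1 this
  filter_upwards [Metric.ball_mem_nhds (0 : C(K, E)) hδ] with h hh
  rw [ContinuousMap.norm_le _ (by positivity)]
  intro k
  have hk : ‖h k‖ ≤ ‖h‖ := h.norm_coe_le_norm k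
  have hlt : ‖h‖ < δ := by simpa using hh
  have key := (convex_ball (u k) δ).norm_image_sub_le_of_norm_hasFDerivWithin_le'
    (f := X) (f' := X') (φ := X' (u k)) (C := ε) (x := u k) (y := u k + h k)
    (fun x _ => (hX x).hasFDerivWithinAt) (by
      intro x hx
      have := @hδ' (u k) x (by rw [dist_comm]; exact hx) (mem_range_self k)
      rw [← dist_eq_norm, dist_comm]
      exact le_of_lt this) (Metric.mem_ball_self hδ) (by
      simp only [Metric.mem_ball, dist_self_add_left]; linarith)
  simp only [add_sub_cancel_left] at key
  change ‖X (u k + h k) - X (u k) - X' (u k) (h k)‖ ≤ _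
  exact key.trans (by gcongr)

theorem contDiff_superposition {E F : Type} [NormedAddCommGroup E] [NormedSpace ℝ E]
    [NormedAddCommGroup F] [NormedSpace ℝ F] (X : C(E, F)) (hX : ContDiff ℝ ∞ X) :
    ContDiff ℝ ∞ (superposition (K := K) X) := by
  rw [contDiff_infty]
  intro n
  induction n generalizing F with
  | zero => exact contDiff_zero.2 (ContinuousMap.continuous_postcomp X)
  | succ n ih =>
    have hX' : ContDiff ℝ ∞ (fderiv ℝ X) := hX.fderiv_right (by simp)
    let X' : C(E, E →L[ℝ] F) := ⟨fderiv ℝ X, hX'.continuous⟩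
    have hd := hasFDerivAt_superposition (K := K) X X'
      (fun x => (hX.differentiable (by simp) x).hasFDerivAt)
    push_cast
    rw [contDiff_succ_iff_fderiv]
    refine ⟨fun u => (hd u).differentiableAt, by simp, ?_⟩
    have : fderiv ℝ (superposition (K := K) X)
        = fun u => pointwiseApply K E F (superposition X' u) := funext fun u => (hd u).fderiv
    rw [this]
    exact (pointwiseApply K E F).contDiff.comp (ih X' hX')

end Superposition

/-! ### Local flows of smooth vector fields -/

/-- The primitive vanishing at `0` of a continuous function on `[0,1]`, as a bounded operator. -/
def primitive (E : Type) [NormedAddCommGroup E] [NormedSpace ℝ E] :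
    C(unitInterval, E) →L[ℝ] C(unitInterval, E) :=
  LinearMap.mkContinuous
    { toFun := fun f => ⟨fun s => ∫ r in (0 : ℝ)..s, IccExtend zero_le_one f r,
        (intervalIntegral.continuous_primitive
          (fun _ _ => (f.continuous.Icc_extend' (h := zero_le_one)).intervalIntegrable _ _)
          0).comp continuous_subtype_val⟩
      map_add' := fun f g => by
        ext s
        exact intervalIntegral.integral_add
          ((f.continuous.Icc_extend' (h := zero_le_one)).intervalIntegrable _ _)
          ((g.continuous.Icc_extend' (h := zero_le_one)).intervalIntegrable _ _)
      map_smul' := fun c f => by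
        ext s
        exact intervalIntegral.integral_smul c _ } 1 (by
    intro f
    rw [ContinuousMap.norm_le _ (by positivity)]
    intro s
    calc ‖∫ r in (0 : ℝ)..s, IccExtend zero_le_one f r‖ ≤ ‖f‖ * |(s : ℝ) - 0| :=
          intervalIntegral.norm_integral_le_of_norm_le_const fun r _ => f.norm_coe_le_norm _
      _ ≤ ‖f‖ * 1 := by
          gcongr
          rw [sub_zero, abs_of_nonneg s.2.1]
          exact s.2.2
      _ = 1 * ‖f‖ := mul_comm _ _)

theorem primitive_apply {E : Type} [NormedAddCommGroup E] [NormedSpace ℝ E]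
    (f : C(unitInterval, E)) (s : unitInterval) :
    primitive E f s = ∫ r in (0 : ℝ)..s, IccExtend zero_le_one f r := rfl

/-- Constant functions, as an operator with values in the continuous functions on `[0,1]`. -/
def constCurve (E : Type) [NormedAddCommGroup E] [NormedSpace ℝ E] :
    E →L[ℝ] C(unitInterval, E) :=
  LinearMap.mkContinuous
    { toFun := fun x => ContinuousMap.const _ x
      map_add' := fun x y => by ext; simp
      map_smul' := fun c x => by ext; simp } 1 (by
    intro x
    rw [ContinuousMap.norm_le _ (by positivity)]
    intro s
    simp)

@[simp]
theorem constCurve_apply {E : Type} [NormedAddCommGroup E] [NormedSpace ℝ E] (x : E)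
    (s : unitInterval) : constCurve E x s = x := rfl

/-- Solutions of `u' = τ X(u)`, `u(0) = x` on `[0,1]` depend smoothly on `(x, τ)` near `τ = 0`: the
integral equation is solved by the inverse function theorem in the Banach space `C([0,1], E)`, the
linearization at `τ = 0` being unipotent. -/
theorem exists_smooth_solution_operator {E : Type} [NormedAddCommGroup E] [NormedSpace ℝ E]
    [CompleteSpace E] (X : C(E, E)) (hX : ContDiff ℝ ∞ X) (ξ : E) :
    ∃ u : E × ℝ → C(unitInterval, E),
      (∀ᶠ p in 𝓝 (ξ, (0 : ℝ)), ContDiffAt ℝ ∞ u p) ∧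
      u (ξ, 0) = constCurve E ξ ∧
      HasFDerivAt u ((constCurve E).comp (ContinuousLinearMap.fst ℝ E ℝ) +
        (ContinuousLinearMap.snd ℝ E ℝ).smulRight
          (primitive E (superposition X (constCurve E ξ)))) (ξ, 0) ∧
      ∀ᶠ p in 𝓝 (ξ, (0 : ℝ)),
        u p = constCurve E p.1 + p.2 • primitive E (superposition X (u p)) := by
  let W := C(unitInterval, E)
  let N : W → W := superposition X
  have hN : ContDiff ℝ ∞ N := contDiff_superposition X hX
  -- Solutions with parameters `(x, τ)` are the points `((x, τ), u)` sent to `((x, τ), 0)`.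
  let G : (E × ℝ) × W → (E × ℝ) × W :=
    fun q => (q.1, q.2 - constCurve E q.1.1 - q.1.2 • primitive E (N q.2))
  have hG : ContDiff ℝ ∞ G := by
    refine contDiff_fst.prodMk ((contDiff_snd.sub
      ((constCurve E).contDiff.comp (contDiff_fst.comp contDiff_fst))).sub ?_)
    exact (contDiff_snd.comp contDiff_fst).smul
      ((primitive E).contDiff.comp (hN.comp contDiff_snd))
  let q₀ : (E × ℝ) × W := ((ξ, 0), constCurve E ξ)
  have hGq₀ : G q₀ = ((ξ, 0), 0) := by simp [G, q₀]
  let ℓ : E × ℝ →L[ℝ] W := (constCurve E).comp (ContinuousLinearMap.fst ℝ E ℝ) +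
    (ContinuousLinearMap.snd ℝ E ℝ).smulRight (primitive E (N (constCurve E ξ)))
  let e : ((E × ℝ) × W) ≃L[ℝ] ((E × ℝ) × W) :=
    ContinuousLinearEquiv.equivOfInverse
      ((ContinuousLinearMap.fst ℝ (E × ℝ) W).prod
        (ContinuousLinearMap.snd ℝ (E × ℝ) W - ℓ.comp (ContinuousLinearMap.fst ℝ (E × ℝ) W)))
      ((ContinuousLinearMap.fst ℝ (E × ℝ) W).prod
        (ContinuousLinearMap.snd ℝ (E × ℝ) W + ℓ.comp (ContinuousLinearMap.fst ℝ (E × ℝ) W)))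
      (fun q => by ext <;> simp) (fun q => by ext <;> simp)
  have hGe : HasFDerivAt G (e : (E × ℝ) × W →L[ℝ] (E × ℝ) × W) q₀ := by
    have hNd : HasFDerivAt (fun q : (E × ℝ) × W => primitive E (N q.2))
        (((primitive E).comp (fderiv ℝ N q₀.2)).comp (ContinuousLinearMap.snd ℝ (E × ℝ) W)) q₀ :=
      ((primitive E).hasFDerivAt.comp _
        ((hN.differentiable (by simp) _).hasFDerivAt)).comp q₀ hasFDerivAt_snd
    have h₁ : HasFDerivAt (fun q : (E × ℝ) × W => q.1.2)
        ((ContinuousLinearMap.snd ℝ E ℝ).comp (ContinuousLinearMap.fst ℝ (E × ℝ) W)) q₀ :=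
      ((ContinuousLinearMap.snd ℝ E ℝ).comp
        (ContinuousLinearMap.fst ℝ (E × ℝ) W)).hasFDerivAt
    have h₂ : HasFDerivAt (fun q : (E × ℝ) × W => constCurve E q.1.1)
        ((constCurve E).comp ((ContinuousLinearMap.fst ℝ E ℝ).comp
          (ContinuousLinearMap.fst ℝ (E × ℝ) W))) q₀ :=
      ((constCurve E).comp ((ContinuousLinearMap.fst ℝ E ℝ).comp
          (ContinuousLinearMap.fst ℝ (E × ℝ) W))).hasFDerivAt
    have := (hasFDerivAt_fst (𝕜 := ℝ) (p := q₀)).prodMk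
      (((hasFDerivAt_snd (𝕜 := ℝ) (p := q₀)).sub h₂).sub (h₁.smul hNd))
    refine this.congr_fderiv ?_
    ext q <;> simp [e, ℓ, q₀]
  let H := hG.contDiffAt.toOpenPartialHomeomorph G hGe (n := ∞) (by simp)
  have hHG : (H : (E × ℝ) × W → (E × ℝ) × W) = G := rfl
  have hsrc : q₀ ∈ H.source := hG.contDiffAt.mem_toOpenPartialHomeomorph_source hGe (by simp)
  have hp₀ : G q₀ ∈ H.target := H.map_source hsrc
  have hsymm₀ : H.symm ((ξ, 0), 0) = q₀ := by rw [← hGq₀]; exact H.left_inv hsrc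
  -- The derivative of `G` stays invertible near the base point.
  have hinv : ∀ᶠ q in 𝓝 ((ξ, (0 : ℝ)), (0 : W)), ContDiffAt ℝ ∞ H.symm q := by
    have hcont : ContinuousAt (fun q => fderiv ℝ G (H.symm q)) ((ξ, (0 : ℝ)), (0 : W)) := by
      have : ContinuousAt H.symm ((ξ, (0 : ℝ)), (0 : W)) := by
        rw [← hGq₀]; exact H.continuousAt_symm hp₀
      exact ((hG.continuous_fderiv (by simp)).continuousAt).comp this
    have hmem := hcont.preimage_mem_nhds (by
      simp only [hsymm₀, hGe.fderiv]
      exact e.nhds)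
    have htgt : H.target ∈ 𝓝 ((ξ, (0 : ℝ)), (0 : W)) := by
      rw [← hGq₀]; exact H.open_target.mem_nhds hp₀
    filter_upwards [hmem, htgt] with q hq hqt
    obtain ⟨e', he'⟩ := hq
    refine H.contDiffAt_symm hqt (f₀' := e') ?_ hG.contDiffAt
    simp only at he'
    rw [he', hHG]
    exact (hG.differentiable (by simp) _).hasFDerivAt
  have hι : ContDiff ℝ ∞ (fun p : E × ℝ => (p, (0 : W))) := contDiff_id.prodMk contDiff_const
  have hιt : Tendsto (fun p : E × ℝ => (p, (0 : W))) (𝓝 (ξ, 0)) (𝓝 ((ξ, 0), 0)) :=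
    hι.continuous.continuousAt
  refine ⟨fun p => (H.symm (p, 0)).2, ?_, ?_, ?_, ?_⟩
  · filter_upwards [hιt.eventually hinv] with p hp
    exact contDiffAt_snd.comp _ (hp.comp p hι.contDiffAt)
  · simp [hsymm₀, q₀]
  · have hs : HasFDerivAt H.symm (e.symm : (E × ℝ) × W →L[ℝ] (E × ℝ) × W) ((ξ, 0), 0) := by
      refine H.hasFDerivAt_symm (hGq₀ ▸ hp₀) ?_
      rw [hsymm₀]
      exact hGe
    have hιd : HasFDerivAt (fun p : E × ℝ => (p, (0 : W)))
        (ContinuousLinearMap.inl ℝ (E × ℝ) W) (ξ, 0) :=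
      (ContinuousLinearMap.inl ℝ (E × ℝ) W).hasFDerivAt
    have := hasFDerivAt_snd.comp (ξ, (0 : ℝ)) (hs.comp (ξ, (0 : ℝ)) hιd)
    refine this.congr_fderiv ?_
    ext p s <;> simp [e, ℓ, N]
  · have htgt : ∀ᶠ p in 𝓝 (ξ, (0 : ℝ)), (p, (0 : W)) ∈ H.target :=
      hιt.eventually (H.open_target.mem_nhds (hGq₀ ▸ hp₀))
    filter_upwards [htgt] with p hp
    have h := H.right_inv hp
    rw [hHG] at h
    have h1 : (H.symm (p, 0)).1 = p := congrArg Prod.fst h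
    have h2 := congrArg Prod.snd h
    simp only [G, h1] at h2
    rw [sub_sub, sub_eq_zero] at h2
    exact h2

/-- Local flow of a smooth vector field `X` on an open set: a smooth map `Φ` near `(ξ, 0)` such
that `Φ (x, τ)` is the value at time `1` of a solution of `c' = τ X(c)` starting at `x`. -/
theorem exists_smooth_local_flow {E : Type} [NormedAddCommGroup E] [NormedSpace ℝ E]
    [FiniteDimensional ℝ E] {X : E → E} {Ω : Set E} (hΩ : IsOpen Ω) (hX : ContDiffOn ℝ ∞ X Ω)
    {ξ : E} (hξ : ξ ∈ Ω) :
    ∃ Φ : E × ℝ → E,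
      (∀ᶠ p in 𝓝 (ξ, (0 : ℝ)), ContDiffAt ℝ ∞ Φ p) ∧
      Φ (ξ, 0) = ξ ∧
      HasFDerivAt Φ (ContinuousLinearMap.fst ℝ E ℝ +
        (ContinuousLinearMap.snd ℝ E ℝ).smulRight (X ξ)) (ξ, 0) ∧
      ∀ N ∈ 𝓝 ξ, ∀ᶠ p in 𝓝 (ξ, (0 : ℝ)), ∃ c : ℝ → E, ContDiff ℝ 1 c ∧ c 0 = p.1 ∧ c 1 = Φ p ∧
        ∀ s ∈ Icc (0 : ℝ) 1, c s ∈ N ∧ HasDerivAt c (p.2 • X (c s)) s := by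
  have : CompleteSpace E := FiniteDimensional.complete ℝ E
  obtain ⟨ρ, hρ, hball⟩ := Metric.isOpen_iff.1 hΩ ξ hξ
  -- A cutoff near `ξ` makes the field globally defined.
  let b : ContDiffBump ξ := ⟨ρ / 3, ρ / 2, by positivity, by linarith⟩
  let Y : E → E := fun x => b x • X x
  have hY : ContDiff ℝ ∞ Y := by
    refine (contMDiff_of_tsupport (I := 𝓘(ℝ, E)) fun x hx => ?_).contDiff
    have hx' : x ∈ tsupport b := tsupport_smul_subset_left b X hx
    rw [b.tsupport_eq] at hx'
    have : x ∈ Ω := hball (Metric.closedBall_subset_ball (by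
      change ρ / 2 < ρ; linarith) hx')
    exact (b.contDiffAt.smul (hX.contDiffAt (hΩ.mem_nhds this))).contMDiffAt
  have hYX : ∀ x ∈ Metric.closedBall ξ (ρ / 3), Y x = X x := fun x hx => by
    simp [Y, b.one_of_mem_closedBall hx]
  obtain ⟨u, hu, hu0, hud, hueq⟩ :=
    exists_smooth_solution_operator ⟨Y, hY.continuous⟩ hY ξ
  let ev : C(unitInterval, E) →L[ℝ] E := ContinuousMap.evalCLM ℝ 1
  have hev : ∀ f, ev f = f 1 := fun f => rfl
  refine ⟨fun p => ev (u p), ?_, ?_, ?_, ?_⟩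
  · filter_upwards [hu] with p hp
    exact ev.contDiff.contDiffAt.comp p hp
  · simp [hu0, hev]
  · refine (ev.hasFDerivAt.comp (ξ, (0 : ℝ)) hud).congr_fderiv ?_
    have hY0 : Y ξ = X ξ := hYX ξ (Metric.mem_closedBall_self (by positivity))
    have : primitive E (superposition ⟨Y, hY.continuous⟩ (constCurve E ξ)) 1 = X ξ := by
      rw [primitive_apply]
      have : IccExtend zero_le_one
          (superposition (K := unitInterval) ⟨Y, hY.continuous⟩ (constCurve E ξ))
          = fun _ : ℝ => Y ξ := by
        funext r; rfl
      rw [this]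
      simp [hY0]
    ext p <;> simp [hev, this]
  · intro N hN
    have hcont : ContinuousAt u (ξ, 0) := hud.continuousAt
    obtain ⟨r, hr, hrN⟩ := Metric.mem_nhds_iff.1 hN
    have hmin : 0 < min r (ρ / 3) := by positivity
    have hnear : ∀ᶠ p in 𝓝 (ξ, (0 : ℝ)), dist (u p) (constCurve E ξ) < min r (ρ / 3) := by
      have := hcont.eventually (Metric.ball_mem_nhds _ hmin)
      rwa [hu0] at this
    filter_upwards [hueq, hnear] with p hp hclose
    have hcl : ∀ s, dist (u p s) ξ < min r (ρ / 3) := fun s =>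
      (ContinuousMap.dist_apply_le_dist s).trans_lt hclose
    let f : ℝ → E := IccExtend zero_le_one (superposition ⟨Y, hY.continuous⟩ (u p))
    have hf : Continuous f := (ContinuousMap.continuous _).Icc_extend' (h := zero_le_one)
    let c : ℝ → E := fun s => p.1 + p.2 • ∫ r in (0 : ℝ)..s, f r
    have hder : ∀ s, HasDerivAt c (p.2 • f s) s := fun s =>
      ((intervalIntegral.integral_hasDerivAt_right (hf.intervalIntegrable _ _)
        hf.aestronglyMeasurable.stronglyMeasurableAtFilter hf.continuousAt).const_smul
        p.2).const_add p.1
    have hcu : ∀ s (hs : s ∈ Icc (0 : ℝ) 1), c s = u p ⟨s, hs⟩ := by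
      intro s hs
      conv_rhs => rw [hp]
      rfl
    refine ⟨c, ?_, ?_, ?_, ?_⟩
    · rw [contDiff_one_iff_deriv]
      refine ⟨fun s => (hder s).differentiableAt, ?_⟩
      have : deriv c = fun s => p.2 • f s := funext fun s => (hder s).deriv
      rw [this]
      exact continuous_const.smul hf
    · simp [c]
    · rw [hcu 1 (right_mem_Icc.2 zero_le_one)]
      rfl
    · intro s hs
      have h1 := hcl ⟨s, hs⟩
      rw [← hcu s hs] at h1
      refine ⟨hrN (h1.trans_le (min_le_left _ _)), ?_⟩
      have h2 : f s = X (c s) := by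
        rw [← hYX (c s) (Metric.mem_closedBall.2 (h1.le.trans (min_le_right _ _))), hcu s hs]
        exact IccExtend_of_mem _ _ hs
      rw [← h2]
      exact hder s

/-! ### Horizontal paths and their energy -/

section Paths

variable {n m : ℕ} {M : Type*} [TopologicalSpace M]
  [ChartedSpace (EuclideanSpace ℝ (Fin n)) M] [IsManifold (𝓡 n) ∞ M]
  {Δ : Distribution n m M} (g : Metric Δ)

theorem Metric.cost_of_mem {x : M} {v : TangentSpace (𝓡 n) x} (h : v ∈ Δ.fiber x) :
    g.cost x v = ENNReal.ofReal (g.form x ⟨v, h⟩ ⟨v, h⟩) := by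
  simp [Metric.cost, h]

theorem Metric.cost_ne_top_iff {x : M} {v : TangentSpace (𝓡 n) x} :
    g.cost x v ≠ ⊤ ↔ v ∈ Δ.fiber x := by
  by_cases h : v ∈ Δ.fiber x
  · simp [g.cost_of_mem h, h]
  · simp [Metric.cost, h]

theorem Metric.form_self_nonneg (x : M) (v : Δ.fiber x) : 0 ≤ g.form x v v := by
  by_cases h : v = 0
  · simp [h]
  · exact (g.pos x v h).le

theorem Metric.cost_smul (x : M) {c : ℝ} (hc : c ≠ 0) (v : TangentSpace (𝓡 n) x) :
    g.cost x (c • v) = ENNReal.ofReal (c ^ 2) * g.cost x v := by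
  by_cases h : v ∈ Δ.fiber x
  · rw [g.cost_of_mem h, g.cost_of_mem ((Δ.fiber x).smul_mem c h),
      ← ENNReal.ofReal_mul (sq_nonneg c)]
    congr 1
    have : (⟨c • v, (Δ.fiber x).smul_mem c h⟩ : Δ.fiber x) = c • ⟨v, h⟩ := rfl
    rw [this]
    simp only [map_smul, LinearMap.smul_apply, smul_eq_mul]
    ring
  · have h' : c • v ∉ Δ.fiber x := by rwa [(Δ.fiber x).smul_mem_iff hc]
    have h1 := mt g.cost_ne_top_iff.1 h
    have h2 := mt g.cost_ne_top_iff.1 h'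
    push Not at h1 h2
    rw [h1, h2, ENNReal.mul_top]
    simp only [ne_eq, ENNReal.ofReal_eq_zero, not_le]
    positivity

/-- The running cost `L_g(γ(t), γ'(t))` along a curve. It is finite exactly when the velocity is
horizontal. -/
def Metric.speed (γ : ℝ → M) (t : ℝ) : ℝ≥0∞ := g.cost (γ t) (velocity γ t)

theorem Metric.speed_congr {γ γ' : ℝ → M} {t : ℝ} (h : γ =ᶠ[𝓝 t] γ') :
    g.speed γ t = g.speed γ' t := by
  have hv : (velocity (n := n) γ t : EuclideanSpace ℝ (Fin n)) = velocity (n := n) γ' t := by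
    have := h.mfderiv_eq (I := 𝓘(ℝ, ℝ)) (I' := 𝓡 n)
    exact DFunLike.congr_fun this (1 : ℝ)
  let c : M → EuclideanSpace ℝ (Fin n) → ℝ≥0∞ := fun x v => g.cost x v
  change c (γ t) _ = c (γ' t) _
  rw [h.eq_of_nhds, hv]

omit [IsManifold (𝓡 n) ∞ M] in
theorem velocity_comp_affine (γ : ℝ → M) {c : ℝ} (hc : c ≠ 0) (d t : ℝ) :
    velocity (n := n) (fun s => γ (c * s + d)) t = c • velocity (n := n) γ (c * t + d) := by
  have hσ : ∀ s, HasDerivAt (fun s : ℝ => c * s + d) c s := fun s => by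
    simpa using ((hasDerivAt_id s).const_mul c).add_const d
  have hσm : ∀ s, HasMFDerivAt 𝓘(ℝ, ℝ) 𝓘(ℝ, ℝ) (fun s : ℝ => c * s + d) s
      (ContinuousLinearMap.toSpanSingleton ℝ c) := fun s => (hσ s).hasFDerivAt.hasMFDerivAt
  unfold velocity
  by_cases h : MDifferentiableAt 𝓘(ℝ, ℝ) (𝓡 n) γ (c * t + d)
  · have h1 := h.hasMFDerivAt.comp t (hσm t)
    have h2 := h1.mfderiv
    have h3 : mfderiv 𝓘(ℝ, ℝ) (𝓡 n) (fun s => γ (c * s + d)) t (1 : ℝ)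
        = mfderiv 𝓘(ℝ, ℝ) (𝓡 n) γ (c * t + d) ((1 : ℝ) • c) :=
      DFunLike.congr_fun h2 (1 : ℝ)
    rw [h3, one_smul]
    have hL : ∀ L : ℝ →L[ℝ] EuclideanSpace ℝ (Fin n), L c = c • L 1 := fun L => by
      rw [← L.map_smul, smul_eq_mul, mul_one]
    exact hL _
  · have h' : ¬ MDifferentiableAt 𝓘(ℝ, ℝ) (𝓡 n) (fun s => γ (c * s + d)) t := by
      intro hd
      apply h
      have hτ : HasDerivAt (fun s : ℝ => c⁻¹ * (s - d)) c⁻¹ (c * t + d) := by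
        simpa using ((hasDerivAt_id (c * t + d)).sub_const d).const_mul c⁻¹
      have ht : c⁻¹ * (c * t + d - d) = t := by field_simp; ring
      have hd' : MDifferentiableAt 𝓘(ℝ, ℝ) (𝓡 n) (fun s => γ (c * s + d))
          (c⁻¹ * (c * t + d - d)) := by rwa [ht]
      have := hd'.comp (c * t + d) hτ.differentiableAt.mdifferentiableAt
      refine this.congr_of_eventuallyEq (Eventually.of_forall fun s => ?_)
      simp only [Function.comp]
      congr 1
      field_simp
      ring
    rw [mfderiv_zero_of_not_mdifferentiableAt h, mfderiv_zero_of_not_mdifferentiableAt h']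
    exact (smul_zero c).symm

theorem Metric.speed_comp_affine (γ : ℝ → M) {c : ℝ} (hc : c ≠ 0) (d t : ℝ) :
    g.speed (fun s => γ (c * s + d)) t = ENNReal.ofReal (c ^ 2) * g.speed γ (c * t + d) := by
  unfold Metric.speed
  rw [velocity_comp_affine γ hc]
  exact g.cost_smul _ hc _

/-- `γ` is a horizontal path on the interval `[a, b]`. That the velocity is almost everywhere in
`Δ` is expressed by the finiteness of the running cost. -/
structure Metric.IsHorizontalOn (γ : ℝ → M) (a b : ℝ) : Prop where
  continuousOn : ContinuousOn γ (Icc a b)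
  absolutelyContinuous : ∀ (z : M) (c d : ℝ), a ≤ c → c ≤ d → d ≤ b →
    MapsTo γ (Icc c d) (chartAt (EuclideanSpace ℝ (Fin n)) z).source →
    AbsolutelyContinuousOnInterval (fun t => chartAt (EuclideanSpace ℝ (Fin n)) z (γ t)) c d
  ae_speed_ne_top : ∀ᵐ t ∂(volume.restrict (Icc a b)), g.speed γ t ≠ ⊤

/-- The energy of `γ` on `[a, b]`. -/
def Metric.energyOn (γ : ℝ → M) (a b : ℝ) : ℝ≥0∞ := ∫⁻ t in Icc a b, g.speed γ t

theorem Metric.isHorizontalPath_iff {γ : ℝ → M} {x y : M} :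
    IsHorizontalPath Δ x y γ ↔ g.IsHorizontalOn γ 0 1 ∧ γ 0 = x ∧ γ 1 = y := by
  constructor
  · intro h
    refine ⟨⟨h.absolutelyContinuous.1, h.absolutelyContinuous.2, ?_⟩, h.source, h.target⟩
    filter_upwards [h.horizontal] with t ht
    exact g.cost_ne_top_iff.2 ht
  · rintro ⟨h, h0, h1⟩
    refine ⟨⟨h.continuousOn, h.absolutelyContinuous⟩, h0, h1, ?_⟩
    filter_upwards [h.ae_speed_ne_top] with t ht
    exact g.cost_ne_top_iff.1 ht

variable {g}

theorem Metric.IsHorizontalOn.mono {γ : ℝ → M} {a b c d : ℝ} (h : g.IsHorizontalOn γ a b)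
    (hac : a ≤ c) (hdb : d ≤ b) : g.IsHorizontalOn γ c d where
  continuousOn := h.continuousOn.mono (Icc_subset_Icc hac hdb)
  absolutelyContinuous z c' d' h1 h2 h3 :=
    h.absolutelyContinuous z c' d' (hac.trans h1) h2 (h3.trans hdb)
  ae_speed_ne_top := ae_restrict_of_ae_restrict_of_subset (Icc_subset_Icc hac hdb)
    h.ae_speed_ne_top

theorem Metric.ae_speed_eq_of_eqOn {γ γ' : ℝ → M} {a b : ℝ} (he : EqOn γ γ' (Icc a b)) :
    ∀ᵐ t ∂(volume.restrict (Icc a b)), g.speed γ t = g.speed γ' t := by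
  rw [← restrict_Ioo_eq_restrict_Icc]
  filter_upwards [ae_restrict_mem measurableSet_Ioo] with t ht
  exact g.speed_congr (he.eventuallyEq_of_mem (Icc_mem_nhds ht.1 ht.2))

theorem Metric.IsHorizontalOn.congr {γ γ' : ℝ → M} {a b : ℝ} (h : g.IsHorizontalOn γ a b)
    (he : EqOn γ γ' (Icc a b)) : g.IsHorizontalOn γ' a b where
  continuousOn := h.continuousOn.congr he.symm
  absolutelyContinuous z c d h1 h2 h3 hm := by
    have hsub : Icc c d ⊆ Icc a b := Icc_subset_Icc h1 h3
    have := h.absolutelyContinuous z c d h1 h2 h3 (fun t ht => by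
      rw [he (hsub ht)]; exact hm ht)
    rw [absolutelyContinuousOnInterval_iff] at this ⊢
    intro ε hε
    obtain ⟨δ, hδ, H⟩ := this ε hε
    refine ⟨δ, hδ, fun E hE hl => ?_⟩
    have hE' := H E hE hl
    rw [Finset.sum_congr rfl fun i hi => ?_] at hE'
    · exact hE'
    · have hi' := hE.1 i hi
      rw [uIcc_of_le h2] at hi'
      simp only [he (hsub hi'.1), he (hsub hi'.2)]
  ae_speed_ne_top := by
    filter_upwards [h.ae_speed_ne_top, Metric.ae_speed_eq_of_eqOn (g := g) he] with t h1 h2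
    rwa [← h2]

theorem Metric.energyOn_congr {γ γ' : ℝ → M} {a b : ℝ} (he : EqOn γ γ' (Icc a b)) :
    g.energyOn γ a b = g.energyOn γ' a b :=
  lintegral_congr_ae (Metric.ae_speed_eq_of_eqOn he)

theorem Metric.energyOn_add (γ : ℝ → M) {a b c : ℝ} (hab : a ≤ b) (hbc : b ≤ c) :
    g.energyOn γ a b + g.energyOn γ b c = g.energyOn γ a c := by
  unfold Metric.energyOn
  rw [setLIntegral_congr (Ioc_ae_eq_Icc (a := b) (b := c)).symm, ← lintegral_union
    measurableSet_Ioc, Icc_union_Ioc_eq_Icc hab hbc]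
  exact Set.disjoint_left.2 fun t h1 h2 => absurd h1.2 (not_le.2 h2.1)

theorem Metric.IsHorizontalOn.union {γ : ℝ → M} {a b c : ℝ} (hab : a ≤ b) (hbc : b ≤ c)
    (h₁ : g.IsHorizontalOn γ a b) (h₂ : g.IsHorizontalOn γ b c) : g.IsHorizontalOn γ a c where
  continuousOn := by
    rw [← Icc_union_Icc_eq_Icc hab hbc]
    exact h₁.continuousOn.union_of_isClosed h₂.continuousOn isClosed_Icc isClosed_Icc
  absolutelyContinuous z c' d' hc' hcd' hd' hm := by
    rcases le_total d' b with hd | hd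
    · exact h₁.absolutelyContinuous z c' d' hc' hcd' hd hm
    rcases le_total b c' with hc | hc
    · exact h₂.absolutelyContinuous z c' d' hc hcd' hd' hm
    exact absolutelyContinuousOnInterval_union hc hd
      (h₁.absolutelyContinuous z c' b hc' hc le_rfl (hm.mono_left (Icc_subset_Icc_right hd)))
      (h₂.absolutelyContinuous z b d' le_rfl hd hd' (hm.mono_left (Icc_subset_Icc_left hc)))
  ae_speed_ne_top := by
    rw [← Icc_union_Icc_eq_Icc hab hbc, ae_restrict_union_eq]
    exact ⟨h₁.ae_speed_ne_top, h₂.ae_speed_ne_top⟩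

/-- An affine change of variable scales Lebesgue measure by its slope. -/
theorem measurePreserving_affine {c : ℝ} (hc : c ≠ 0) (d : ℝ) :
    MeasurePreserving (fun t : ℝ => c * t + d) (ENNReal.ofReal |c| • volume) volume := by
  refine ⟨by fun_prop, ?_⟩
  have h1 : Measure.map (fun t : ℝ => c * t + d) volume
      = Measure.map (fun t => t + d) (Measure.map (fun t => c * t) volume) := by
    rw [Measure.map_map (by fun_prop) (by fun_prop)]
    rfl
  rw [Measure.map_smul, h1, ← Measure.map_smul, Real.smul_map_volume_mul_left hc,
    map_add_right_eq_self]

theorem measurableEmbedding_affine {c : ℝ} (hc : c ≠ 0) (d : ℝ) :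
    MeasurableEmbedding (fun t : ℝ => c * t + d) :=
  (affineHomeomorph c d hc).measurableEmbedding

theorem Metric.energyOn_comp_affine (γ : ℝ → M) {c : ℝ} (hc : c ≠ 0) {a b a' b' d : ℝ}
    (hpre : (fun t : ℝ => c * t + d) ⁻¹' Icc a b = Icc a' b') :
    g.energyOn (fun t => γ (c * t + d)) a' b' = ENNReal.ofReal |c| * g.energyOn γ a b := by
  unfold Metric.energyOn
  have h1 := (measurePreserving_affine hc d).setLIntegral_comp_preimage_emb
    (measurableEmbedding_affine hc d) (g.speed γ) (Icc a b)
  rw [hpre, Measure.restrict_smul, lintegral_smul_measure] at h1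
  simp_rw [g.speed_comp_affine γ hc]
  rw [lintegral_const_mul' _ _ ENNReal.ofReal_ne_top, ← h1, ← sq_abs, sq,
    ENNReal.ofReal_mul (abs_nonneg c), mul_assoc, smul_eq_mul]

theorem Metric.IsHorizontalOn.comp_affine {γ : ℝ → M} {c : ℝ} (hc : c ≠ 0) {a b a' b' d : ℝ}
    (h : g.IsHorizontalOn γ a b) (hpre : (fun t : ℝ => c * t + d) ⁻¹' Icc a b = Icc a' b') :
    g.IsHorizontalOn (fun t => γ (c * t + d)) a' b' where
  continuousOn := h.continuousOn.comp (by fun_prop) (fun t ht => by rwa [← hpre] at ht)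
  absolutelyContinuous z c' d' hc' hcd' hd' hm := by
    have hsub : ∀ t ∈ Icc c' d', c * t + d ∈ Icc a b := fun t ht => by
      have : t ∈ Icc a' b' := ⟨hc'.trans ht.1, ht.2.trans hd'⟩
      rwa [← hpre] at this
    have hlip : LipschitzWith ‖c‖₊ (fun t : ℝ => c * t + d) := by
      refine LipschitzWith.of_dist_le_mul fun x y => ?_
      simp only [dist_add_right, coe_nnnorm, Real.dist_eq, Real.norm_eq_abs]
      rw [← mul_sub, abs_mul]
    have himg : ∀ t, t ∈ uIcc (c * c' + d) (c * d' + d) →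
        ∃ s ∈ Icc c' d', c * s + d = t := fun t ht => by
      have : ContinuousOn (fun t : ℝ => c * t + d) (uIcc c' d') := by fun_prop
      obtain ⟨s, hs, hst⟩ := intermediate_value_uIcc this ht
      rw [uIcc_of_le hcd'] at hs
      exact ⟨s, hs, hst⟩
    have hmaps : MapsTo (fun t : ℝ => c * t + d) (uIcc c' d') (uIcc (c * c' + d) (c * d' + d)) := by
      intro t ht
      rw [uIcc_of_le hcd'] at ht
      rcases hc.lt_or_gt with h0 | h0
      · rw [uIcc_of_ge (by nlinarith)]
        exact ⟨by nlinarith [ht.2], by nlinarith [ht.1]⟩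
      · rw [uIcc_of_le (by nlinarith)]
        exact ⟨by nlinarith [ht.1], by nlinarith [ht.2]⟩
    have hAC : AbsolutelyContinuousOnInterval
        (fun t => chartAt (EuclideanSpace ℝ (Fin n)) z (γ t)) (c * c' + d) (c * d' + d) := by
      have h1 := hsub c' (left_mem_Icc.2 hcd')
      have h2 := hsub d' (right_mem_Icc.2 hcd')
      have hmap' : ∀ t ∈ uIcc (c * c' + d) (c * d' + d),
          γ t ∈ (chartAt (EuclideanSpace ℝ (Fin n)) z).source := by
        intro t ht
        obtain ⟨s, hs, rfl⟩ := himg t ht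
        exact hm hs
      rcases le_total (c * c' + d) (c * d' + d) with hle | hle
      · rw [uIcc_of_le hle] at hmap'
        exact h.absolutelyContinuous z _ _ h1.1 hle h2.2 hmap'
      · rw [uIcc_of_ge hle] at hmap'
        exact (h.absolutelyContinuous z _ _ h2.1 hle h1.2 hmap').symm
    refine absolutelyContinuousOnInterval_comp hAC hlip ?_ hmaps
    rcases hc.lt_or_gt with h0 | h0
    · exact Or.inr fun x y hxy => by
        simp only; nlinarith
    · exact Or.inl fun x y hxy => by
        simp only; nlinarith
  ae_speed_ne_top := by
    have h1 := h.ae_speed_ne_top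
    rw [ae_restrict_iff' measurableSet_Icc] at h1 ⊢
    have h2 := (measurePreserving_affine hc d).quasiMeasurePreserving.ae h1
    rw [Measure.ae_ennreal_smul_measure_eq (by simpa using hc)] at h2
    filter_upwards [h2] with t ht htm
    rw [g.speed_comp_affine γ hc]
    rw [← hpre] at htm
    exact ENNReal.mul_ne_top ENNReal.ofReal_ne_top (ht htm)

variable (g)

theorem Metric.eValue_lt_iff {x y : M} {A : ℝ≥0∞} : g.eValue x y < A ↔
    ∃ γ : ℝ → M, g.IsHorizontalOn γ 0 1 ∧ γ 0 = x ∧ γ 1 = y ∧ g.energyOn γ 0 1 < A := by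
  unfold Metric.eValue
  simp only [iInf_lt_iff, g.isHorizontalPath_iff, exists_prop, and_assoc]
  rfl

variable {g}

/-- The part of a horizontal path between times `0` and `s`, run at speed `s`. -/
theorem Metric.eValue_le_of_isHorizontalOn {γ : ℝ → M} {s : ℝ} (hs : 0 < s)
    (h : g.IsHorizontalOn γ 0 s) :
    g.eValue (γ 0) (γ s) ≤ ENNReal.ofReal s * g.energyOn γ 0 s := by
  have hpre : (fun t : ℝ => s * t + 0) ⁻¹' Icc 0 s = Icc 0 1 := by
    ext t
    simp only [add_zero, mem_preimage, mem_Icc, mul_nonneg_iff_of_pos_left hs]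
    exact and_congr_right fun _ => by
      constructor <;> intro h <;> nlinarith
  have h1 := h.comp_affine hs.ne' hpre
  have h2 := Metric.energyOn_comp_affine (g := g) γ hs.ne' hpre
  rw [abs_of_pos hs] at h2
  rw [← h2]
  exact iInf₂_le (fun t => γ (s * t + 0)) (g.isHorizontalPath_iff.2 ⟨h1, by simp, by simp⟩)

variable (g)

theorem Metric.eValue_comm (x y : M) : g.eValue x y = g.eValue y x := by
  have key : ∀ x y, g.eValue y x ≤ g.eValue x y := by
    intro x y
    refine le_of_forall_gt fun A hA => ?_
    obtain ⟨γ, hγ, h0, h1, hE⟩ := g.eValue_lt_iff.1 hA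
    have hpre : (fun t : ℝ => (-1) * t + 1) ⁻¹' Icc 0 1 = Icc 0 1 := by
      ext t
      simp only [mem_preimage, mem_Icc]
      constructor <;> rintro ⟨h, h'⟩ <;> constructor <;> linarith
    rw [g.eValue_lt_iff]
    refine ⟨_, hγ.comp_affine (by norm_num) hpre, by simpa using h1, by simpa using h0, ?_⟩
    rw [Metric.energyOn_comp_affine γ (by norm_num) hpre]
    simpa using hE
  exact le_antisymm (key y x) (key x y)

/-- Concatenation: the first path is run during the time `s`, the second one during `1 - s`. -/
theorem Metric.eValue_triangle {x y z : M} {A B s : ℝ} (hs : 0 < s) (hs1 : s < 1)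
    (hxy : g.eValue x y < ENNReal.ofReal A) (hyz : g.eValue y z < ENNReal.ofReal B) :
    g.eValue x z < ENNReal.ofReal (A / s + B / (1 - s)) := by
  obtain ⟨γ₁, h₁, h₁0, h₁1, hE₁⟩ := g.eValue_lt_iff.1 hxy
  obtain ⟨γ₂, h₂, h₂0, h₂1, hE₂⟩ := g.eValue_lt_iff.1 hyz
  have hs' : 0 < 1 - s := by linarith
  have hA : 0 < A := ENNReal.ofReal_pos.1 (pos_of_gt hE₁)
  have hB : 0 < B := ENNReal.ofReal_pos.1 (pos_of_gt hE₂)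
  have hpre₁ : (fun t : ℝ => s⁻¹ * t + 0) ⁻¹' Icc 0 1 = Icc 0 s := by
    ext t
    simp only [mem_preimage, mem_Icc, add_zero, inv_mul_le_one₀ hs]
    rw [mul_nonneg_iff_of_pos_left (by positivity)]
  have hpre₂ : (fun t : ℝ => (1 - s)⁻¹ * t + -((1 - s)⁻¹ * s)) ⁻¹' Icc 0 1 = Icc s 1 := by
    ext t
    have : (1 - s)⁻¹ * t + -((1 - s)⁻¹ * s) = (1 - s)⁻¹ * (t - s) := by ring
    simp only [mem_preimage, mem_Icc, this, inv_mul_le_one₀ hs']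
    rw [mul_nonneg_iff_of_pos_left (by positivity)]
    constructor <;> rintro ⟨h, h'⟩ <;> constructor <;> linarith
  let γ : ℝ → M := fun t => if t ≤ s then γ₁ (s⁻¹ * t + 0)
    else γ₂ ((1 - s)⁻¹ * t + -((1 - s)⁻¹ * s))
  have e₁ : EqOn (fun t => γ₁ (s⁻¹ * t + 0)) γ (Icc 0 s) := fun t ht => by simp [γ, ht.2]
  have e₂ : EqOn (fun t => γ₂ ((1 - s)⁻¹ * t + -((1 - s)⁻¹ * s))) γ (Icc s 1) := fun t ht => by
    rcases ht.1.eq_or_lt with rfl | hlt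
    · simp [γ, hs.ne', h₁1, h₂0]
    · simp [γ, not_le.2 hlt]
  refine g.eValue_lt_iff.2 ⟨γ, ?_, ?_, ?_, ?_⟩
  · exact ((h₁.comp_affine (by positivity) hpre₁).congr e₁).union hs.le hs1.le
      ((h₂.comp_affine (by positivity) hpre₂).congr e₂)
  · simp [γ, hs.le, h₁0]
  · have : (1 - s)⁻¹ + -((1 - s)⁻¹ * s) = 1 := by field_simp; ring
    simp [γ, not_le.2 hs1, this, h₂1]
  · rw [← Metric.energyOn_add γ hs.le hs1.le, ← Metric.energyOn_congr e₁,
      ← Metric.energyOn_congr e₂, Metric.energyOn_comp_affine γ₁ (by positivity) hpre₁,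
      Metric.energyOn_comp_affine γ₂ (by positivity) hpre₂, abs_of_pos (by positivity),
      abs_of_pos (by positivity), ENNReal.ofReal_add (by positivity) (by positivity),
      div_eq_inv_mul, div_eq_inv_mul, ENNReal.ofReal_mul (by positivity),
      ENNReal.ofReal_mul (by positivity)]
    have p₁ : ENNReal.ofReal s⁻¹ ≠ 0 := by simpa using hs
    have p₂ : ENNReal.ofReal (1 - s)⁻¹ ≠ 0 := by simpa using hs1
    exact ENNReal.add_lt_add
      ((ENNReal.mul_lt_mul_iff_right p₁ ENNReal.ofReal_ne_top).2 hE₁)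
      ((ENNReal.mul_lt_mul_iff_right p₂ ENNReal.ofReal_ne_top).2 hE₂)

end Paths

/-! ### Vector fields and horizontal curves in a chart -/

section Charts

variable {n m : ℕ} {M : Type*} [TopologicalSpace M]
  [ChartedSpace (EuclideanSpace ℝ (Fin n)) M]

/-- The vector field `X` read in the chart around `z`. -/
def chartField (z : M) (X : ∀ y : M, TangentSpace (𝓡 n) y) :
    EuclideanSpace ℝ (Fin n) → EuclideanSpace ℝ (Fin n) :=
  VectorField.mpullback 𝓘(ℝ, EuclideanSpace ℝ (Fin n)) (𝓡 n) (extChartAt (𝓡 n) z).symm X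

/-- The part of the chart domain around `z`, in coordinates, that corresponds to points of `U`. -/
def chartDomain (n : ℕ) {M : Type*} [TopologicalSpace M]
    [ChartedSpace (EuclideanSpace ℝ (Fin n)) M] (z : M) (U : Set M) :
    Set (EuclideanSpace ℝ (Fin n)) :=
  (extChartAt (𝓡 n) z).target ∩ (extChartAt (𝓡 n) z).symm ⁻¹' U

theorem isOpen_chartDomain (z : M) {U : Set M} (hU : IsOpen U) : IsOpen (chartDomain n z U) :=
  (continuousOn_extChartAt_symm z).isOpen_inter_preimage (isOpen_extChartAt_target z) hU

theorem mem_chartDomain {z y : M} {U : Set M} (hz : y ∈ (extChartAt (𝓡 n) z).source)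
    (hy : y ∈ U) : extChartAt (𝓡 n) z y ∈ chartDomain n z U :=
  ⟨(extChartAt (𝓡 n) z).map_source hz, by
    simpa only [mem_preimage, (extChartAt (𝓡 n) z).left_inv hz] using hy⟩

variable [IsManifold (𝓡 n) ∞ M]

theorem contMDiffAt_extChartAt_symm {z : M} {ξ : EuclideanSpace ℝ (Fin n)}
    (hξ : ξ ∈ (extChartAt (𝓡 n) z).target) :
    ContMDiffAt 𝓘(ℝ, EuclideanSpace ℝ (Fin n)) (𝓡 n) ∞ (extChartAt (𝓡 n) z).symm ξ :=
  (contMDiffOn_extChartAt_symm z).contMDiffAt ((isOpen_extChartAt_target z).mem_nhds hξ)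

theorem isInvertible_mfderiv_extChartAt_symm {z : M} {ξ : EuclideanSpace ℝ (Fin n)}
    (hξ : ξ ∈ (extChartAt (𝓡 n) z).target) :
    (mfderiv 𝓘(ℝ, EuclideanSpace ℝ (Fin n)) (𝓡 n) (extChartAt (𝓡 n) z).symm ξ).IsInvertible := by
  have : IsManifold (𝓡 n) 1 M := .of_le (n := ∞) (by simp)
  have := isInvertible_mfderivWithin_extChartAt_symm (I := 𝓡 n) hξ
  rwa [ModelWithCorners.range_eq_univ, mfderivWithin_univ] at this

theorem mfderiv_chartField {z : M} {ξ : EuclideanSpace ℝ (Fin n)}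
    (hξ : ξ ∈ (extChartAt (𝓡 n) z).target) (X : ∀ y : M, TangentSpace (𝓡 n) y) :
    mfderiv 𝓘(ℝ, EuclideanSpace ℝ (Fin n)) (𝓡 n) (extChartAt (𝓡 n) z).symm ξ
      (chartField z X ξ) = X ((extChartAt (𝓡 n) z).symm ξ) := by
  rw [chartField, VectorField.mpullback_apply]
  exact (isInvertible_mfderiv_extChartAt_symm hξ).self_apply_inverse _

theorem contDiffOn_chartField (z : M) {X : ∀ y : M, TangentSpace (𝓡 n) y} {U : Set M}
    (hU : IsOpen U) (hX : SmoothVectorFieldOn X U) :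
    ContDiffOn ℝ ∞ (chartField z X) (chartDomain n z U) := by
  intro ξ hξ
  have h1 : ContMDiffAt (𝓡 n) (𝓡 n).tangent ∞ (fun y => (⟨y, X y⟩ : TangentBundle (𝓡 n) M))
      ((extChartAt (𝓡 n) z).symm ξ) := hX.contMDiffAt (hU.mem_nhds hξ.2)
  have := h1.mpullback_vectorField_preimage (contMDiffAt_extChartAt_symm hξ.1)
    (isInvertible_mfderiv_extChartAt_symm hξ.1) (by simp)
  exact (contMDiffAt_vectorSpace_iff_contDiffAt.1 this).contDiffWithinAt

theorem chartField_mlieBracket (z : M) {X Y : ∀ y : M, TangentSpace (𝓡 n) y} {U : Set M}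
    (hU : IsOpen U) (hX : SmoothVectorFieldOn X U) (hY : SmoothVectorFieldOn Y U)
    {ξ : EuclideanSpace ℝ (Fin n)} (hξ : ξ ∈ chartDomain n z U) :
    chartField z (VectorField.mlieBracket (𝓡 n) X Y) ξ =
      VectorField.lieBracket ℝ (chartField z X) (chartField z Y) ξ := by
  have h3 : IsManifold (𝓡 n) (minSmoothness ℝ 3) M :=
    .of_le (n := ∞) (by simp only [minSmoothness_of_isRCLikeNormedField]; exact ENat.LEInfty.out)
  have hd : ∀ {Z : ∀ y : M, TangentSpace (𝓡 n) y}, SmoothVectorFieldOn Z U →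
      MDifferentiableAt (𝓡 n) (𝓡 n).tangent (fun y => (⟨y, Z y⟩ : TangentBundle (𝓡 n) M))
        ((extChartAt (𝓡 n) z).symm ξ) := fun hZ =>
    (hZ.contMDiffAt (hU.mem_nhds hξ.2)).mdifferentiableAt (by simp)
  have := VectorField.mpullback_mlieBracket (n := ∞) (hd hX) (hd hY)
    (contMDiffAt_extChartAt_symm hξ.1)
    (by simp only [minSmoothness_of_isRCLikeNormedField]; exact ENat.LEInfty.out)
  rw [chartField, this, ← VectorField.mlieBracketWithin_univ,
    VectorField.mlieBracketWithin_eq_lieBracketWithin]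
  exact congrFun (VectorField.lieBracketWithin_univ (𝕜 := ℝ) (V := chartField z X)
    (W := chartField z Y)) ξ

theorem SmoothVectorFieldOn.mlieBracket {X Y : ∀ y : M, TangentSpace (𝓡 n) y} {U : Set M}
    (hU : IsOpen U) (hX : SmoothVectorFieldOn X U) (hY : SmoothVectorFieldOn Y U) :
    SmoothVectorFieldOn (VectorField.mlieBracket (𝓡 n) X Y) U := by
  intro y hy
  have h2 : IsManifold (𝓡 n) (minSmoothness ℝ 2) M :=
    .of_le (n := ∞) (by simp only [minSmoothness_of_isRCLikeNormedField]; exact ENat.LEInfty.out)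
  have h3 : IsManifold (𝓡 n) (((⊤ : ℕ∞) : WithTop ℕ∞) + 1) M := .of_le (n := ∞) (by simp)
  exact (ContMDiffAt.mlieBracket_vectorField (n := ⊤) (m := ⊤)
    (hX.contMDiffAt (hU.mem_nhds hy)) (hY.contMDiffAt (hU.mem_nhds hy))
    (by simp)).contMDiffWithinAt

theorem MemLieAlgebra.smooth {f : Fin m → ∀ y : M, TangentSpace (𝓡 n) y} {U : Set M}
    (hU : IsOpen U) (hf : ∀ i, SmoothVectorFieldOn (f i) U) {X : ∀ y : M, TangentSpace (𝓡 n) y}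
    (hX : MemLieAlgebra f X) : SmoothVectorFieldOn X U := by
  induction hX with
  | of i => exact hf i
  | zero => exact (Bundle.contMDiff_zeroSection ℝ (TangentSpace (𝓡 n) (M := M))).contMDiffOn
  | add _ _ h1 h2 => exact h1.add_section h2
  | smul c _ h => exact ContMDiffOn.const_smul_section h
  | bracket _ _ h1 h2 => exact h1.mlieBracket hU h2

variable {Δ : Distribution n m M} (g : Metric Δ)

open Classical in
/-- The section of `Δ` that agrees with `X` wherever `X` is tangent to `Δ`, and vanishes
elsewhere. -/
def Distribution.toSection (Δ : Distribution n m M) (X : ∀ y : M, TangentSpace (𝓡 n) y) (y : M) :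
    Δ.fiber y :=
  if h : X y ∈ Δ.fiber y then ⟨X y, h⟩ else 0

theorem Distribution.coe_toSection {X : ∀ y : M, TangentSpace (𝓡 n) y} {y : M}
    (h : X y ∈ Δ.fiber y) : (Δ.toSection X y : TangentSpace (𝓡 n) y) = X y := by
  simp [Distribution.toSection, h]

theorem Metric.continuousOn_form {X Y : ∀ y : M, TangentSpace (𝓡 n) y} {U : Set M}
    (hU : IsOpen U) (hX : SmoothVectorFieldOn X U) (hXΔ : ∀ y ∈ U, X y ∈ Δ.fiber y)
    (hY : SmoothVectorFieldOn Y U) (hYΔ : ∀ y ∈ U, Y y ∈ Δ.fiber y) :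
    ContinuousOn (fun y => g.form y (Δ.toSection X y) (Δ.toSection Y y)) U := by
  refine (g.smooth U hU _ _ (hX.congr fun y hy => ?_) (hY.congr fun y hy => ?_)).continuousOn
  · simp only [Distribution.coe_toSection (hXΔ y hy)]
  · simp only [Distribution.coe_toSection (hYΔ y hy)]

theorem Metric.cost_smul_of_mem {y : M} {X : ∀ y : M, TangentSpace (𝓡 n) y}
    (h : X y ∈ Δ.fiber y) (τ : ℝ) :
    g.cost y (τ • X y)
      = ENNReal.ofReal (τ ^ 2 * g.form y (Δ.toSection X y) (Δ.toSection X y)) := by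
  rw [g.cost_of_mem ((Δ.fiber y).smul_mem τ h)]
  have : (⟨τ • X y, (Δ.fiber y).smul_mem τ h⟩ : Δ.fiber y) = τ • Δ.toSection X y :=
    Subtype.ext (by rw [Submodule.coe_smul, Distribution.coe_toSection h])
  rw [this]
  simp only [map_smul, LinearMap.smul_apply, smul_eq_mul]
  congr 1
  ring

/-- A `C¹` curve in a chart that solves `c' = τ X(c)`, for a section `X` of `Δ`, is a horizontal
path; its energy is at most `τ²` times a bound of `g(X, X)` along it. -/
theorem Metric.eValue_le_of_chart_curve {z : M} {X : ∀ y : M, TangentSpace (𝓡 n) y} {U : Set M}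
    {C τ : ℝ} (hXΔ : ∀ y ∈ U, X y ∈ Δ.fiber y)
    (hC : ∀ y ∈ U, g.form y (Δ.toSection X y) (Δ.toSection X y) ≤ C)
    {c : ℝ → EuclideanSpace ℝ (Fin n)} (hc : ContDiff ℝ 1 c)
    (hcU : ∀ s ∈ Icc (0 : ℝ) 1, c s ∈ chartDomain n z U)
    (hcd : ∀ s ∈ Icc (0 : ℝ) 1, HasDerivAt c (τ • chartField z X (c s)) s) :
    g.eValue ((extChartAt (𝓡 n) z).symm (c 0)) ((extChartAt (𝓡 n) z).symm (c 1)) ≤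
      ENNReal.ofReal (C * τ ^ 2) := by
  let γ : ℝ → M := fun s => (extChartAt (𝓡 n) z).symm (c s)
  have hvel : ∀ s ∈ Icc (0 : ℝ) 1, velocity (n := n) γ s = τ • X (γ s) := by
    intro s hs
    have h1 := ((contMDiffAt_extChartAt_symm (hcU s hs).1).mdifferentiableAt
      (by simp)).hasMFDerivAt.comp s (hcd s hs).hasFDerivAt.hasMFDerivAt
    have h2 : velocity (n := n) γ s = mfderiv 𝓘(ℝ, EuclideanSpace ℝ (Fin n)) (𝓡 n)
        (extChartAt (𝓡 n) z).symm (c s) ((1 : ℝ) • (τ • chartField z X (c s))) :=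
      DFunLike.congr_fun h1.mfderiv (1 : ℝ)
    rw [h2, one_smul, ← mfderiv_chartField (hcU s hs).1 X]
    exact (mfderiv 𝓘(ℝ, EuclideanSpace ℝ (Fin n)) (𝓡 n)
      (extChartAt (𝓡 n) z).symm (c s)).map_smul τ (chartField z X (c s))
  have hspeed : ∀ s ∈ Icc (0 : ℝ) 1, g.speed γ s ≤ ENNReal.ofReal (C * τ ^ 2) := by
    intro s hs
    rw [Metric.speed, hvel s hs, g.cost_smul_of_mem (hXΔ _ (hcU s hs).2), mul_comm C]
    exact ENNReal.ofReal_le_ofReal (mul_le_mul_of_nonneg_left (hC _ (hcU s hs).2) (sq_nonneg τ))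
  have hsm : ContMDiffOn 𝓘(ℝ, ℝ) (𝓡 n) 1 γ (Icc 0 1) :=
    ((contMDiffOn_extChartAt_symm (n := ∞) z).of_le (by simp)).comp hc.contMDiff.contMDiffOn
      (fun s hs => (hcU s hs).1)
  have hγ : g.IsHorizontalOn γ 0 1 := by
    refine ⟨hsm.continuousOn, fun z' a b ha hab hb hm => ?_, ?_⟩
    · have h1 : ContMDiffOn (𝓡 n) 𝓘(ℝ, EuclideanSpace ℝ (Fin n)) 1 (extChartAt (𝓡 n) z')
          (chartAt (EuclideanSpace ℝ (Fin n)) z').source :=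
        (contMDiffOn_extChartAt (n := ∞)).of_le (by simp)
      have h2 := h1.comp (hsm.mono (Icc_subset_Icc ha hb)) hm
      rw [contMDiffOn_iff_contDiffOn, ← uIcc_of_le hab] at h2
      exact h2.absolutelyContinuousOnInterval
    · filter_upwards [ae_restrict_mem measurableSet_Icc] with s hs
      exact ne_top_of_le_ne_top ENNReal.ofReal_ne_top (hspeed s hs)
  calc g.eValue (γ 0) (γ 1) ≤ g.energyOn γ 0 1 :=
        iInf₂_le γ (g.isHorizontalPath_iff.2 ⟨hγ, rfl, rfl⟩)
    _ ≤ ∫⁻ _ in Icc (0 : ℝ) 1, ENNReal.ofReal (C * τ ^ 2) :=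
        setLIntegral_mono' measurableSet_Icc hspeed
    _ = ENNReal.ofReal (C * τ ^ 2) := by simp

/-- The local flow of a section `X` of `Δ`, in the chart around `z`: it moves points along
horizontal paths of energy at most `C τ²` as soon as `g(X, X) < C`. -/
theorem Metric.exists_horizontal_flow {z y₀ : M} (hz : y₀ ∈ (extChartAt (𝓡 n) z).source)
    {X : ∀ y : M, TangentSpace (𝓡 n) y} {U : Set M} (hU : IsOpen U) (hy₀ : y₀ ∈ U)
    (hX : SmoothVectorFieldOn X U) (hXΔ : ∀ y ∈ U, X y ∈ Δ.fiber y) :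
    ∃ Φ : EuclideanSpace ℝ (Fin n) × ℝ → EuclideanSpace ℝ (Fin n),
      (∀ᶠ p in 𝓝 (extChartAt (𝓡 n) z y₀, (0 : ℝ)), ContDiffAt ℝ ∞ Φ p) ∧
      Φ (extChartAt (𝓡 n) z y₀, 0) = extChartAt (𝓡 n) z y₀ ∧
      HasFDerivAt Φ (ContinuousLinearMap.fst ℝ (EuclideanSpace ℝ (Fin n)) ℝ +
        (ContinuousLinearMap.snd ℝ (EuclideanSpace ℝ (Fin n)) ℝ).smulRight
          (chartField z X (extChartAt (𝓡 n) z y₀))) (extChartAt (𝓡 n) z y₀, 0) ∧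
      ∀ C, g.form y₀ (Δ.toSection X y₀) (Δ.toSection X y₀) < C →
        ∀ᶠ p in 𝓝 (extChartAt (𝓡 n) z y₀, (0 : ℝ)),
          g.eValue ((extChartAt (𝓡 n) z).symm p.1) ((extChartAt (𝓡 n) z).symm (Φ p)) ≤
            ENNReal.ofReal (C * p.2 ^ 2) := by
  obtain ⟨Φ, h1, h2, h3, h4⟩ := exists_smooth_local_flow (isOpen_chartDomain z hU)
    (contDiffOn_chartField z hU hX) (mem_chartDomain hz hy₀)
  refine ⟨Φ, h1, h2, h3, fun C hC => ?_⟩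
  have hcont : ContinuousAt (fun y => g.form y (Δ.toSection X y) (Δ.toSection X y)) y₀ :=
    (g.continuousOn_form hU hX hXΔ hX hXΔ).continuousAt (hU.mem_nhds hy₀)
  obtain ⟨V, hVsub, hV, hy₀V⟩ := mem_nhds_iff.1 (inter_mem (hU.mem_nhds hy₀)
    (hcont.eventually (gt_mem_nhds hC)))
  filter_upwards [h4 _ ((isOpen_chartDomain z hV).mem_nhds (mem_chartDomain hz hy₀V))]
    with p ⟨c, hc, hc0, hc1, hcs⟩
  rw [← hc0, ← hc1]
  exact g.eValue_le_of_chart_curve (U := V) (fun y hy => hXΔ y (hVsub hy).1)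
    (fun y hy => (hVsub hy).2.le) hc (fun s hs => (hcs s hs).1) (fun s hs => (hcs s hs).2)

end Charts

/-! ### Local controllability -/

section Chow

variable {n m : ℕ} {M : Type*} [TopologicalSpace M]
  [ChartedSpace (EuclideanSpace ℝ (Fin n)) M] [IsManifold (𝓡 n) ∞ M]

/-- If `A` lifts along an immersion germ `F` pointwise near `t₀`, it has a smooth lift: compose
with a left inverse `P` of `DF(t₀)` and invert `P ∘ DF(t)`. -/
theorem exists_smooth_lift {E T : Type} [NormedAddCommGroup E] [NormedSpace ℝ E]
    [NormedAddCommGroup T] [NormedSpace ℝ T] [FiniteDimensional ℝ T]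
    [FiniteDimensional ℝ E] {F : T → E} {t₀ : T} (hF : ContDiffAt ℝ ∞ F t₀)
    (hinj : Function.Injective (fderiv ℝ F t₀)) {A : T → E} (hA : ContDiffAt ℝ ∞ A t₀)
    (hrange : ∀ᶠ t in 𝓝 t₀, A t ∈ range (fderiv ℝ F t)) :
    ∃ a : T → T, ContDiffAt ℝ ∞ a t₀ ∧ ∀ᶠ t in 𝓝 t₀, fderiv ℝ F t (a t) = A t := by
  have : CompleteSpace T := FiniteDimensional.complete ℝ T
  obtain ⟨P₀, hP₀⟩ := (fderiv ℝ F t₀).toLinearMap.exists_leftInverse_of_injective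
    (LinearMap.ker_eq_bot.2 hinj)
  let P : E →L[ℝ] T := LinearMap.toContinuousLinearMap P₀
  let B : T → T →L[ℝ] T := fun t => P.comp (fderiv ℝ F t)
  have hB : ContDiffAt ℝ ∞ B t₀ :=
    contDiffAt_const.clm_comp (hF.fderiv_right (m := ∞) (by simp))
  have hB₀ : B t₀ = (ContinuousLinearEquiv.refl ℝ T : T →L[ℝ] T) := by
    ext t
    exact DFunLike.congr_fun hP₀ t
  have hinv : ContDiffAt ℝ ∞ (fun t => ContinuousLinearMap.inverse (B t)) t₀ := by
    refine ContDiffAt.comp t₀ (g := ContinuousLinearMap.inverse) ?_ hB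
    rw [hB₀]
    exact contDiffAt_map_inverse _
  have hev : ∀ᶠ t in 𝓝 t₀, B t ∈ range ((↑) : (T ≃L[ℝ] T) → T →L[ℝ] T) := by
    refine hB.continuousAt.preimage_mem_nhds ?_
    rw [hB₀]
    exact ContinuousLinearEquiv.nhds _
  refine ⟨fun t => ContinuousLinearMap.inverse (B t) (P (A t)),
    hinv.clm_apply (P.contDiff.contDiffAt.comp t₀ hA), ?_⟩
  filter_upwards [hev, hrange] with t ⟨e, he⟩ ⟨w, hw⟩
  have : P (A t) = e w := by
    rw [← hw]
    exact (DFunLike.congr_fun he w).symm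
  rw [this, ← he, ContinuousLinearMap.inverse_equiv]
  simp [hw]

/-- If near `t₀` all generating fields are tangent to the image of the immersion germ `F`, so is
every field of the generated Lie algebra, since `F`-related fields have `F`-related brackets. -/
theorem MemLieAlgebra.exists_smooth_lift {f : Fin m → ∀ y : M, TangentSpace (𝓡 n) y} {U : Set M}
    (hU : IsOpen U) (hf : ∀ i, SmoothVectorFieldOn (f i) U) {z : M}
    {T : Type} [NormedAddCommGroup T] [NormedSpace ℝ T] [FiniteDimensional ℝ T]
    {F : T → EuclideanSpace ℝ (Fin n)} {t₀ : T} (hF : ContDiffAt ℝ ∞ F t₀)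
    (hFU : F t₀ ∈ chartDomain n z U) (hinj : Function.Injective (fderiv ℝ F t₀))
    (hrange : ∀ᶠ t in 𝓝 t₀, ∀ i, chartField z (f i) (F t) ∈ range (fderiv ℝ F t))
    {X : ∀ y : M, TangentSpace (𝓡 n) y} (hX : MemLieAlgebra f X) :
    ∃ a : T → T, ContDiffAt ℝ ∞ a t₀ ∧
      ∀ᶠ t in 𝓝 t₀, fderiv ℝ F t (a t) = chartField z X (F t) := by
  have hopen := isOpen_chartDomain (n := n) z hU
  have hcf : ∀ {Y : ∀ y : M, TangentSpace (𝓡 n) y}, MemLieAlgebra f Y → ∀ x ∈ chartDomain n z U,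
      ContDiffAt ℝ ∞ (chartField z Y) x := fun hY x hx =>
    (contDiffOn_chartField z hU (hY.smooth hU hf)).contDiffAt (hopen.mem_nhds hx)
  have hFev : ∀ᶠ t in 𝓝 t₀, F t ∈ chartDomain n z U :=
    hF.continuousAt.preimage_mem_nhds (hopen.mem_nhds hFU)
  have hF2 : ∀ᶠ t in 𝓝 t₀, ContDiffAt ℝ 2 F t :=
    (hF.of_le (m := 2) ENat.LEInfty.out).eventually (by simp)
  induction hX with
  | of i =>
    exact SubRiemannian.exists_smooth_lift hF hinj ((hcf (.of i) _ hFU).comp t₀ hF)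
      (hrange.mono fun t ht => ht i)
  | zero =>
    refine ⟨fun _ => 0, contDiffAt_const, Eventually.of_forall fun t => ?_⟩
    rw [map_zero, chartField, VectorField.mpullback_zero]
    rfl
  | add _ _ h1 h2 =>
    obtain ⟨a, ha, hae⟩ := h1
    obtain ⟨b, hb, hbe⟩ := h2
    refine ⟨fun t => a t + b t, ha.add hb, ?_⟩
    filter_upwards [hae, hbe] with t h1 h2
    rw [map_add, h1, h2]
    exact (VectorField.mpullback_add_apply ..).symm
  | smul c _ h =>
    obtain ⟨a, ha, hae⟩ := h
    refine ⟨fun t => c • a t, ha.const_smul c, ?_⟩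
    filter_upwards [hae] with t h1
    rw [map_smul, h1]
    exact (VectorField.mpullback_const_smul_apply ..).symm
  | @bracket Y Z hY hZ h1 h2 =>
    obtain ⟨a, ha, hae⟩ := h1
    obtain ⟨b, hb, hbe⟩ := h2
    refine ⟨VectorField.lieBracket ℝ a b, ha.lieBracket_vectorField hb (by simp), ?_⟩
    have ha1 : ∀ᶠ t in 𝓝 t₀, ContDiffAt ℝ 1 a t :=
      (ha.of_le (m := 1) ENat.LEInfty.out).eventually (by simp)
    have hb1 : ∀ᶠ t in 𝓝 t₀, ContDiffAt ℝ 1 b t :=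
      (hb.of_le (m := 1) ENat.LEInfty.out).eventually (by simp)
    filter_upwards [hae.eventually_nhds, hbe.eventually_nhds, ha1, hb1, hF2, hFev]
      with t hat hbt hat1 hbt1 hFt hFtU
    have hFd : DifferentiableAt ℝ F t := hFt.differentiableAt (by simp)
    have key : ∀ {W : ∀ y : M, TangentSpace (𝓡 n) y} {d : T → T}, MemLieAlgebra f W →
        (∀ᶠ s in 𝓝 t, fderiv ℝ F s (d s) = chartField z W (F s)) → ∀ w,
        fderiv ℝ (fun s => fderiv ℝ F s (d s)) t w
          = fderiv ℝ (chartField z W) (F t) (fderiv ℝ F t w) := by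
      intro W d hW hd w
      have h1 : (fun s => fderiv ℝ F s (d s)) =ᶠ[𝓝 t] fun s => chartField z W (F s) := hd
      rw [h1.fderiv_eq]
      have := ((hcf hW _ hFtU).differentiableAt (by simp)).hasFDerivAt.comp t hFd.hasFDerivAt
      exact DFunLike.congr_fun this.fderiv w
    rw [VectorField.fderiv_apply_lieBracket hFt (by simp) (hbt1.differentiableAt (by simp))
      (hat1.differentiableAt (by simp)), key hZ hbt, key hY hat, hat.self_of_nhds,
      hbt.self_of_nhds, chartField_mlieBracket z hU (hY.smooth hU hf) (hZ.smooth hU hf) hFtU]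
    rfl

variable {Δ : Distribution n m M} (g : Metric Δ)

theorem Metric.eValue_self (x : M) : g.eValue x x = 0 := by
  have h := g.eValue_le_of_chart_curve (z := x) (X := 0) (U := univ) (C := 0) (τ := 0)
    (fun y _ => (Δ.fiber y).zero_mem)
    (fun y _ => by
      have : Δ.toSection 0 y = 0 := Subtype.ext (Distribution.coe_toSection (Δ.fiber y).zero_mem)
      simp [this])
    (c := fun _ => extChartAt (𝓡 n) x x) contDiff_const
    (fun s _ => mem_chartDomain (mem_extChartAt_source x) (mem_univ _))
    (fun s _ => by rw [zero_smul]; exact hasDerivAt_const _ _)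
  simpa using h

/-- Points near `x₀` can be steered by a `k`-dimensional smooth family of horizontal motions of
arbitrarily small energy, the end points of those issued from `x₀` forming an immersed
submanifold near a central parameter `t₀`, for which the end point is in `U`. Points are given by
their coordinates in the chart around `x₀`. -/
def Metric.Steerable (x₀ : M) (U : Set M) (k : ℕ) : Prop :=
  ∀ ε > (0 : ℝ), ∃ (T : Type) (_ : NormedAddCommGroup T) (_ : NormedSpace ℝ T)
    (_ : FiniteDimensional ℝ T) (F : EuclideanSpace ℝ (Fin n) × T → EuclideanSpace ℝ (Fin n))
    (t₀ : T), Module.finrank ℝ T = k ∧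
    (∀ᶠ p in 𝓝 (extChartAt (𝓡 n) x₀ x₀, t₀), ContDiffAt ℝ ∞ F p) ∧
    (∀ᶠ p in 𝓝 (extChartAt (𝓡 n) x₀ x₀, t₀),
      g.eValue ((extChartAt (𝓡 n) x₀).symm p.1) ((extChartAt (𝓡 n) x₀).symm (F p)) <
        ENNReal.ofReal ε) ∧
    F (extChartAt (𝓡 n) x₀ x₀, t₀) ∈ chartDomain n x₀ U ∧
    Function.Injective (fderiv ℝ (fun t => F (extChartAt (𝓡 n) x₀ x₀, t)) t₀)

theorem Metric.steerable_zero {x₀ : M} {U : Set M} (hx₀ : x₀ ∈ U) : g.Steerable x₀ U 0 := by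
  intro ε hε
  refine ⟨EuclideanSpace ℝ (Fin 0), inferInstance, inferInstance, inferInstance, Prod.fst, 0,
    by simp, Eventually.of_forall fun p => contDiffAt_fst, Eventually.of_forall fun p => ?_,
    mem_chartDomain (mem_extChartAt_source x₀) hx₀, Function.injective_of_subsingleton _⟩
  rw [g.eValue_self]
  exact ENNReal.ofReal_pos.2 hε

/-- The rank of a steering family that is not yet open can be raised: by Hörmander's condition one
of the generating fields is transverse to the image at some nearby parameter, and following its
flow adds a dimension. -/
theorem Metric.Steerable.succ {f : Fin m → ∀ y : M, TangentSpace (𝓡 n) y} {x₀ : M} {U : Set M}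
    (hU : IsOpen U) (hf : Represents f Δ.fiber U)
    (hLie : ∀ y ∈ U, ∀ v : TangentSpace (𝓡 n) y, ∃ X, MemLieAlgebra f X ∧ X y = v)
    {k : ℕ} (hk : k < n) (h : g.Steerable x₀ U k) : g.Steerable x₀ U (k + 1) := by
  intro ε hε
  obtain ⟨T, _, _, _, F, t₀, hT, hF, hE, hFU, hinj⟩ := h (ε / 4) (by positivity)
  set ξ := extChartAt (𝓡 n) x₀ x₀ with hξ
  let f₀ : T → EuclideanSpace ℝ (Fin n) := fun t => F (ξ, t)
  have hι : ∀ t : T, Tendsto (fun t : T => (ξ, t)) (𝓝 t) (𝓝 (ξ, t)) := fun t =>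
    (Continuous.prodMk_right ξ).continuousAt
  have hsm : ∀ t, ContDiffAt ℝ ∞ F (ξ, t) → ContDiffAt ℝ ∞ f₀ t := fun t ht =>
    ht.comp t (contDiffAt_const.prodMk contDiffAt_id)
  have hf₀ : ContDiffAt ℝ ∞ f₀ t₀ := hsm t₀ hF.self_of_nhds
  have hopen := isOpen_chartDomain (n := n) x₀ hU
  -- Hörmander's condition forbids that all fields stay tangent to the image.
  have hex : ∃ᶠ t in 𝓝 t₀, ∃ i, chartField x₀ (f i) (f₀ t) ∉ range (fderiv ℝ f₀ t) := by
    intro hcon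
    have hrange : ∀ᶠ t in 𝓝 t₀, ∀ i, chartField x₀ (f i) (f₀ t) ∈ range (fderiv ℝ f₀ t) :=
      hcon.mono fun t ht => by push Not at ht; exact ht
    have hsurj : Function.Surjective (fderiv ℝ f₀ t₀) := by
      intro v
      obtain ⟨X, hX, hXv⟩ := hLie _ hFU.2
        (mfderiv 𝓘(ℝ, EuclideanSpace ℝ (Fin n)) (𝓡 n) (extChartAt (𝓡 n) x₀).symm (f₀ t₀) v)
      obtain ⟨a, -, ha⟩ := hX.exists_smooth_lift hU hf.smooth hf₀ hFU hinj hrange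
      refine ⟨a t₀, ?_⟩
      rw [ha.self_of_nhds]
      refine (isInvertible_mfderiv_extChartAt_symm hFU.1).injective ?_
      rw [mfderiv_chartField hFU.1]
      exact hXv
    have := LinearMap.finrank_le_finrank_of_surjective (f := (fderiv ℝ f₀ t₀).toLinearMap) hsurj
    rw [hT, finrank_euclideanSpace_fin] at this
    omega
  have hinj_ev : ∀ᶠ t in 𝓝 t₀, Function.Injective (fderiv ℝ f₀ t) := by
    have hc : ContinuousAt (fderiv ℝ f₀) t₀ :=
      (hf₀.fderiv_right (m := ∞) (by simp)).continuousAt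
    exact hc.eventually (ContinuousLinearMap.isOpen_injective.mem_nhds hinj)
  obtain ⟨t₁, ⟨i, hi⟩, hF₁, hE₁, hinj₁, hU₁⟩ := (hex.and_eventually
    (((hι t₀).eventually hF.eventually_nhds).and (((hι t₀).eventually hE.eventually_nhds).and
      (hinj_ev.and (hf₀.continuousAt.eventually (hopen.mem_nhds hFU)))))).exists
  have hf₁ : ContDiffAt ℝ ∞ f₀ t₁ := hsm t₁ hF₁.self_of_nhds
  -- Follow the flow of the transverse field.
  set y₁ := (extChartAt (𝓡 n) x₀).symm (f₀ t₁) with hy₁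
  have hφy₁ : extChartAt (𝓡 n) x₀ y₁ = f₀ t₁ := (extChartAt (𝓡 n) x₀).right_inv hU₁.1
  have hfΔ : ∀ y ∈ U, f i y ∈ Δ.fiber y := fun y hy => by
    rw [hf.span_eq y hy]
    exact Submodule.subset_span (mem_range_self i)
  obtain ⟨Φ, hΦ, hΦ0, hΦd, hΦE⟩ := g.exists_horizontal_flow (z := x₀) (y₀ := y₁)
    ((extChartAt (𝓡 n) x₀).map_target hU₁.1) hU hU₁.2 (hf.smooth i) hfΔ
  rw [hφy₁] at hΦ hΦ0 hΦd hΦE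
  let C := max 0 (g.form y₁ (Δ.toSection (f i) y₁) (Δ.toSection (f i) y₁)) + 1
  have hC : 0 < C := by positivity
  have hCE := hΦE C (by
    have := le_max_right 0 (g.form y₁ (Δ.toSection (f i) y₁) (Δ.toSection (f i) y₁))
    change _ < max 0 _ + 1
    linarith)
  let G : EuclideanSpace ℝ (Fin n) × (T × ℝ) → EuclideanSpace ℝ (Fin n) × ℝ :=
    fun q => (F (q.1, q.2.1), q.2.2)
  have hπ : ContinuousAt (fun q : EuclideanSpace ℝ (Fin n) × (T × ℝ) => (q.1, q.2.1))
      (ξ, (t₁, 0)) := by fun_prop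
  have hG : ContinuousAt G (ξ, (t₁, 0)) := by
    refine ContinuousAt.prodMk ?_ (by fun_prop)
    exact ContinuousAt.comp (g := F) hF₁.self_of_nhds.continuousAt hπ
  have hG0 : G (ξ, (t₁, 0)) = (f₀ t₁, 0) := rfl
  refine ⟨T × ℝ, inferInstance, inferInstance, inferInstance, fun q => Φ (G q), (t₁, 0), ?_, ?_,
    ?_, ?_, ?_⟩
  · rw [Module.finrank_prod, hT, Module.finrank_self]
  · filter_upwards [hπ.eventually hF₁, hG.eventually (by rw [hG0]; exact hΦ)] with q hq1 hq2
    refine hq2.comp q (ContDiffAt.prodMk ?_ (contDiffAt_snd.comp q contDiffAt_snd))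
    exact ContDiffAt.comp (g := F) q hq1
      (contDiffAt_fst.prodMk (contDiffAt_fst.comp q contDiffAt_snd))
  · have hsmall : ∀ᶠ q in 𝓝 (ξ, ((t₁, 0) : T × ℝ)), C * q.2.2 ^ 2 < ε / 4 := by
      have hc : ContinuousAt (fun q : EuclideanSpace ℝ (Fin n) × (T × ℝ) => C * q.2.2 ^ 2)
        (ξ, (t₁, 0)) := by fun_prop
      refine hc.eventually (gt_mem_nhds ?_)
      simpa using hε
    filter_upwards [hπ.eventually hE₁, hG.eventually (by rw [hG0]; exact hCE), hsmall]
      with q hq1 hq2 hq3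
    have hq2' := hq2.trans_lt ((ENNReal.ofReal_lt_ofReal_iff (by positivity)).2 hq3)
    have := g.eValue_triangle (s := 1 / 2) (by norm_num) (by norm_num) hq1 hq2'
    have harith : ε / 4 / (1 / 2) + ε / 4 / (1 - 1 / 2) = ε := by ring
    rwa [harith] at this
  · change Φ (f₀ t₁, 0) ∈ _
    rw [hΦ0]
    exact hU₁
  · have h1 : HasFDerivAt (fun r : T × ℝ => f₀ r.1)
        ((fderiv ℝ f₀ t₁).comp (ContinuousLinearMap.fst ℝ T ℝ)) (t₁, 0) :=
      HasFDerivAt.comp (g := f₀) (t₁, (0 : ℝ)) (hf₁.differentiableAt (by simp)).hasFDerivAt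
        hasFDerivAt_fst
    have h2 := HasFDerivAt.comp (g := Φ) (t₁, (0 : ℝ)) hΦd (h1.prodMk hasFDerivAt_snd)
    have h3 : fderiv ℝ (fun r : T × ℝ => Φ (G (ξ, r))) (t₁, 0) = _ := h2.fderiv
    rw [h3, injective_iff_map_eq_zero]
    rintro ⟨a, b⟩ hab
    have hab' : fderiv ℝ f₀ t₁ a + b • chartField x₀ (f i) (f₀ t₁) = 0 := by simpa using hab
    have hb : b = 0 := by
      by_contra hb
      refine hi ⟨-(b⁻¹ • a), ?_⟩
      rw [map_neg, map_smul, eq_neg_of_add_eq_zero_left hab', smul_neg, neg_neg, smul_smul,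
        inv_mul_cancel₀ hb, one_smul]
    subst hb
    rw [zero_smul, add_zero] at hab'
    rw [(injective_iff_map_eq_zero _).1 hinj₁ a hab']
    rfl

/-- Chow's theorem with small energy: the image of a steering family of full rank is open, and the
motion with the central parameter moves a neighborhood of `x₀` into it. -/
theorem Metric.eventually_eValue_lt (hΔ : Δ.IsNonholonomic) (x₀ : M) {ε : ℝ} (hε : 0 < ε) :
    ∀ᶠ x in 𝓝 x₀, g.eValue x₀ x < ENNReal.ofReal ε := by
  obtain ⟨U, hU, hx₀, f, hf, hLie⟩ := hΔ x₀
  have hsteer : ∀ k ≤ n, g.Steerable x₀ U k := by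
    intro k
    induction k with
    | zero => exact fun _ => g.steerable_zero hx₀
    | succ k ih => exact fun hk => (ih (by omega)).succ g hU hf hLie (by omega)
  obtain ⟨T, _, _, _, F, t₀, hT, hF, hE, -, hinj⟩ := hsteer n le_rfl (ε / 4) (by positivity)
  have : CompleteSpace T := FiniteDimensional.complete ℝ T
  set ξ := extChartAt (𝓡 n) x₀ x₀ with hξ
  let f₀ : T → EuclideanSpace ℝ (Fin n) := fun t => F (ξ, t)
  have hf₀ : ContDiffAt ℝ ∞ f₀ t₀ :=
    hF.self_of_nhds.comp t₀ (contDiffAt_const.prodMk contDiffAt_id)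
  have hsurj : Function.Surjective (fderiv ℝ f₀ t₀).toLinearMap :=
    (LinearMap.injective_iff_surjective_of_finrank_eq_finrank
      (by rw [hT, finrank_euclideanSpace_fin])).1 hinj
  have hmap := (hf₀.hasStrictFDerivAt (by simp)).map_nhds_eq_of_surj
    (LinearMap.range_eq_top.2 hsurj)
  have hS : ∀ᶠ t in 𝓝 t₀, g.eValue ((extChartAt (𝓡 n) x₀).symm ξ)
      ((extChartAt (𝓡 n) x₀).symm (f₀ t)) < ENNReal.ofReal (ε / 4) :=
    (Continuous.prodMk_right ξ).continuousAt.eventually hE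
  have himg := image_mem_map (m := f₀) hS
  rw [hmap] at himg
  have hj : ContinuousAt (fun x => (extChartAt (𝓡 n) x₀ x, t₀)) x₀ :=
    (continuousAt_extChartAt x₀).prodMk continuousAt_const
  have hψ : ContinuousAt (fun x => F (extChartAt (𝓡 n) x₀ x, t₀)) x₀ :=
    ContinuousAt.comp (g := F) hF.self_of_nhds.continuousAt hj
  filter_upwards [hψ.eventually himg, hj.eventually hE, extChartAt_source_mem_nhds (I := 𝓡 n) x₀]
    with x ⟨t, ht, htx⟩ hx hxs
  rw [(extChartAt (𝓡 n) x₀).left_inv hxs, g.eValue_comm] at hx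
  have ht' : g.eValue x₀ ((extChartAt (𝓡 n) x₀).symm (F (extChartAt (𝓡 n) x₀ x, t₀))) <
      ENNReal.ofReal (ε / 4) := by
    rw [← htx]
    simpa [hξ] using ht
  have := g.eValue_triangle (s := 1 / 2) (by norm_num) (by norm_num) ht' hx
  have harith : ε / 4 / (1 / 2) + ε / 4 / (1 - 1 / 2) = ε := by ring
  rwa [harith] at this

end Chow

/-! ### Finiteness and continuity of the value function -/

section Value

variable {n m : ℕ} {M : Type*} [TopologicalSpace M]
  [ChartedSpace (EuclideanSpace ℝ (Fin n)) M] [IsManifold (𝓡 n) ∞ M]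
  {Δ : Distribution n m M} (g : Metric Δ)

theorem Metric.eValue_ne_top [ConnectedSpace M] (hΔ : Δ.IsNonholonomic) (xbar x : M) :
    g.eValue xbar x ≠ ⊤ := by
  have htri : ∀ {x y z : M}, g.eValue x y ≠ ⊤ → g.eValue y z ≠ ⊤ → g.eValue x z ≠ ⊤ := by
    have key : ∀ {x y : M}, g.eValue x y ≠ ⊤ →
        g.eValue x y < ENNReal.ofReal ((g.eValue x y).toReal + 1) := fun h => by
      rw [ENNReal.lt_ofReal_iff_toReal_lt h]
      linarith
    intro x y z hxy hyz
    exact ((g.eValue_triangle (s := 1 / 2) (by norm_num) (by norm_num) (key hxy)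
      (key hyz)).trans ENNReal.ofReal_lt_top).ne
  have hloc : ∀ x : M, ∀ᶠ y in 𝓝 x, g.eValue x y ≠ ⊤ := fun x =>
    (g.eventually_eValue_lt hΔ x one_pos).mono fun y hy => (hy.trans ENNReal.ofReal_lt_top).ne
  have hclopen : IsClopen {x | g.eValue xbar x ≠ ⊤} := by
    refine ⟨⟨isOpen_iff_mem_nhds.2 fun x hx => ?_⟩, isOpen_iff_mem_nhds.2 fun x hx => ?_⟩
    · filter_upwards [hloc x] with y hy hy'
      rw [g.eValue_comm] at hy
      exact hx (htri hy' hy)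
    · filter_upwards [hloc x] with y hy
      exact htri hx hy
  have := hclopen.eq_univ ⟨xbar, by simp [g.eValue_self]⟩
  exact Set.eq_univ_iff_forall.1 this x

variable {g}

theorem Metric.eValue_lt_ofReal_iff {x y : M} (h : g.eValue x y ≠ ⊤) {A : ℝ} :
    g.eValue x y < ENNReal.ofReal A ↔ g.value x y < A :=
  ENNReal.lt_ofReal_iff_toReal_lt h

variable (g)

theorem Metric.value_nonneg (x y : M) : 0 ≤ g.value x y := ENNReal.toReal_nonneg

/-- Prolonging a path by one of very small energy hardly changes the energy. -/
theorem Metric.exists_eValue_lt_add {B η : ℝ} (hB : 0 ≤ B) (hη : 0 < η) :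
    ∃ ε > 0, ∀ x y z : M, ∀ A ≤ B, g.eValue x y < ENNReal.ofReal A →
      g.eValue y z < ENNReal.ofReal ε → g.eValue x z < ENNReal.ofReal (A + η) := by
  -- The first path takes the time `1 / (1 + θ)`, which multiplies its energy by `1 + θ`.
  let θ := η / (2 * (B + 1))
  have hθ : 0 < θ := by positivity
  have hs : 0 < 1 - 1 / (1 + θ) := by
    rw [sub_pos, div_lt_one (by positivity)]
    linarith
  refine ⟨(1 - 1 / (1 + θ)) * (η / 2), by positivity, fun x y z A hA hxy hyz => ?_⟩
  refine (g.eValue_triangle (s := 1 / (1 + θ)) (by positivity) (by linarith) hxy hyz).trans_le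
    (ENNReal.ofReal_le_ofReal ?_)
  have h1 : A / (1 / (1 + θ)) = A + A * θ := by field_simp
  have h2 : (1 - 1 / (1 + θ)) * (η / 2) / (1 - 1 / (1 + θ)) = η / 2 :=
    mul_div_cancel_left₀ _ hs.ne'
  have h3 : A * θ ≤ B * θ := by gcongr
  have h4 : B * θ ≤ η / 2 := by
    have : (B + 1) * θ = η / 2 := by simp only [θ]; field_simp
    linarith
  rw [h1, h2]
  linarith

theorem Metric.continuous_value [ConnectedSpace M] (hΔ : Δ.IsNonholonomic) (xbar : M) :
    Continuous (g.value xbar) := by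
  rw [continuous_iff_continuousAt]
  intro x
  rw [ContinuousAt, Metric.tendsto_nhds]
  intro η hη
  have hV := g.value_nonneg xbar
  obtain ⟨ε, hε, H⟩ := g.exists_eValue_lt_add (B := g.value xbar x + η + 1)
    (by linarith [hV x]) (half_pos hη)
  have hfin := g.eValue_ne_top hΔ xbar
  have step : ∀ y z, g.value xbar y ≤ g.value xbar x + η → g.eValue y z < ENNReal.ofReal ε →
      g.value xbar z < g.value xbar y + η := by
    intro y z hy hyz
    let δ := min 1 (η / 2)
    have hδ : 0 < δ := by positivity
    have h1 : δ ≤ 1 := min_le_left _ _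
    have h2 : δ ≤ η / 2 := min_le_right _ _
    have := H xbar y z (g.value xbar y + δ) (by linarith)
      ((Metric.eValue_lt_ofReal_iff (hfin y)).2 (by linarith)) hyz
    rw [Metric.eValue_lt_ofReal_iff (hfin z)] at this
    linarith
  filter_upwards [g.eventually_eValue_lt hΔ x hε] with y hy
  have h1 := step x y (by linarith) hy
  have h2 := step y x h1.le (by rwa [g.eValue_comm])
  rw [Real.dist_eq, abs_lt]
  constructor <;> linarith

end Value

/-! ### Growth of functions along horizontal paths -/

section Growth

variable {n m : ℕ} {M : Type*} [TopologicalSpace M]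
  [ChartedSpace (EuclideanSpace ℝ (Fin n)) M] [IsManifold (𝓡 n) ∞ M]
  {Δ : Distribution n m M} (g : Metric Δ)

theorem Metric.sub_form_le_hamiltonian (x : M) (p : TangentSpace (𝓡 n) x →L[ℝ] ℝ)
    (v : Δ.fiber x) : p v - g.form x v v ≤ 2 * g.hamiltonian x ((1 / 2 : ℝ) • p) := by
  have := (g.isGreatest_hamiltonian x ((1 / 2 : ℝ) • p)).2 ⟨v, rfl⟩
  simp only [smul_apply, smul_eq_mul] at this
  linarith

theorem contDiffAt_comp_extChartAt_symm {f : M → ℝ} {U : Set M} (hU : IsOpen U)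
    (hf : ContMDiffOn (𝓡 n) 𝓘(ℝ, ℝ) 1 f U) {z : M} {ξ : EuclideanSpace ℝ (Fin n)}
    (hξ : ξ ∈ chartDomain n z U) :
    ContDiffAt ℝ 1 (fun η => f ((extChartAt (𝓡 n) z).symm η)) ξ := by
  rw [← contMDiffAt_iff_contDiffAt]
  exact (hf.contMDiffAt (hU.mem_nhds hξ.2)).comp ξ
    ((contMDiffAt_extChartAt_symm hξ.1).of_le (by simp))

theorem continuousAt_differential_apply {f : M → ℝ} {U : Set M} (hU : IsOpen U)
    (hf : ContMDiffOn (𝓡 n) 𝓘(ℝ, ℝ) 1 f U) {X : ∀ y : M, TangentSpace (𝓡 n) y}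
    (hX : SmoothVectorFieldOn X U) {x₀ : M} (hx₀ : x₀ ∈ U) :
    ContinuousAt (fun x => differential f x (X x)) x₀ := by
  let k : EuclideanSpace ℝ (Fin n) → ℝ := fun η => f ((extChartAt (𝓡 n) x₀).symm η)
  have hmem := mem_chartDomain (mem_extChartAt_source (I := 𝓡 n) x₀) hx₀
  have hk : ContinuousAt (fun η => fderiv ℝ k η (chartField x₀ X η)) (extChartAt (𝓡 n) x₀ x₀) :=
    (((contDiffAt_comp_extChartAt_symm hU hf hmem).fderiv_right (m := 0)
      (by simp)).continuousAt).clm_apply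
      ((contDiffOn_chartField x₀ hU hX).contDiffAt
        ((isOpen_chartDomain x₀ hU).mem_nhds hmem)).continuousAt
  have hk' := ContinuousAt.comp (f := extChartAt (𝓡 n) x₀) hk (continuousAt_extChartAt x₀)
  refine hk'.congr ?_
  filter_upwards [extChartAt_source_mem_nhds (I := 𝓡 n) x₀, hU.mem_nhds hx₀] with x hxs hxU
  have hξ := mem_chartDomain (n := n) hxs hxU
  have h1 : MDifferentiableAt (𝓡 n) 𝓘(ℝ, ℝ) f
      ((extChartAt (𝓡 n) x₀).symm (extChartAt (𝓡 n) x₀ x)) :=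
    (hf.contMDiffAt (hU.mem_nhds hξ.2)).mdifferentiableAt (by simp)
  have h2 := h1.hasMFDerivAt.comp (extChartAt (𝓡 n) x₀ x)
    ((contMDiffAt_extChartAt_symm hξ.1).mdifferentiableAt (by simp)).hasMFDerivAt
  let A : EuclideanSpace ℝ (Fin n) →L[ℝ] ℝ :=
    differential f ((extChartAt (𝓡 n) x₀).symm (extChartAt (𝓡 n) x₀ x))
  let B : EuclideanSpace ℝ (Fin n) →L[ℝ] EuclideanSpace ℝ (Fin n) :=
    mfderiv 𝓘(ℝ, EuclideanSpace ℝ (Fin n)) (𝓡 n) (extChartAt (𝓡 n) x₀).symm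
      (extChartAt (𝓡 n) x₀ x)
  have h3 : HasFDerivAt k (A.comp B) (extChartAt (𝓡 n) x₀ x) := hasMFDerivAt_iff_hasFDerivAt.1 h2
  have h4 : fderiv ℝ k (extChartAt (𝓡 n) x₀ x) (chartField x₀ X (extChartAt (𝓡 n) x₀ x))
      = differential f ((extChartAt (𝓡 n) x₀).symm (extChartAt (𝓡 n) x₀ x))
        (mfderiv 𝓘(ℝ, EuclideanSpace ℝ (Fin n)) (𝓡 n) (extChartAt (𝓡 n) x₀).symm
          (extChartAt (𝓡 n) x₀ x) (chartField x₀ X (extChartAt (𝓡 n) x₀ x))) := by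
    rw [h3.fderiv]
    rfl
  rw [Function.comp_apply, h4, mfderiv_chartField hξ.1, (extChartAt (𝓡 n) x₀).left_inv hxs]

theorem continuousAt_inv_mulVec {X : Type*} [TopologicalSpace X] {m : ℕ}
    {G : X → Matrix (Fin m) (Fin m) ℝ} {b : X → Fin m → ℝ} {x : X} (hG : ContinuousAt G x)
    (hb : ContinuousAt b x) (hx : (G x).det ≠ 0) :
    ContinuousAt (fun y => (1 / 2 : ℝ) • (G y)⁻¹.mulVec (b y)) x := by
  have hdet : ContinuousAt (fun y => (G y).det) x :=
    (Continuous.matrix_det continuous_id).continuousAt.comp hG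
  have hadj : ContinuousAt (fun y => (G y).adjugate) x :=
    (Continuous.matrix_adjugate continuous_id).continuousAt.comp hG
  have hinv : ContinuousAt (fun y => (G y)⁻¹) x := by
    simp only [Matrix.inv_def, Ring.inverse_eq_inv']
    exact (hdet.inv₀ hx).smul hadj
  have hmul : Continuous fun q : Matrix (Fin m) (Fin m) ℝ × (Fin m → ℝ) => q.1.mulVec q.2 :=
    continuous_fst.matrix_mulVec continuous_snd
  have h : ContinuousAt (fun y => (G y)⁻¹.mulVec (b y)) x :=
    hmul.continuousAt.comp (hinv.prodMk hb)
  exact h.const_smul (1 / 2 : ℝ)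

theorem continuousAt_dotProduct {X : Type*} [TopologicalSpace X] {m : ℕ} {v w : X → Fin m → ℝ}
    {x : X} (hv : ContinuousAt v x) (hw : ContinuousAt w x) :
    ContinuousAt (fun y => ∑ i, v y i * w y i) x :=
  tendsto_finsetSum _ fun i _ => (continuousAt_pi.1 hv i).mul (continuousAt_pi.1 hw i)

/-- Upper semicontinuity of the Hamiltonian along the differential of a `C¹` function. In a local
frame the maximizing vector is given by inverting the Gram matrix, so it depends continuously on
the point. -/
theorem Metric.eventually_differential_le {f : M → ℝ} {U : Set M} (hU : IsOpen U)
    (hf : ContMDiffOn (𝓡 n) 𝓘(ℝ, ℝ) 1 f U) {x₀ : M} (hx₀ : x₀ ∈ U) {K : ℝ}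
    (hK : ∀ v : Δ.fiber x₀, differential (n := n) f x₀ v - g.form x₀ v v < K) :
    ∀ᶠ x in 𝓝 x₀, ∀ v : Δ.fiber x, differential (n := n) f x v ≤ K + g.form x v v := by
  obtain ⟨U', hU', hx₀', e, he⟩ := Δ.exists_represents x₀
  have heΔ : ∀ i, ∀ y ∈ U', e i y ∈ Δ.fiber y := fun i y hy => by
    rw [he.span_eq y hy]
    exact Submodule.subset_span (mem_range_self i)
  let s : Fin m → ∀ y : M, Δ.fiber y := fun i y => Δ.toSection (e i) y
  have hs : ∀ i, ∀ y ∈ U', (s i y : TangentSpace (𝓡 n) y) = e i y := fun i y hy =>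
    Distribution.coe_toSection (heΔ i y hy)
  let G : M → Matrix (Fin m) (Fin m) ℝ := fun x => .of fun i j => g.form x (s i x) (s j x)
  let b : M → Fin m → ℝ := fun x i => differential f x (e i x)
  let comb : ∀ x : M, (Fin m → ℝ) → Δ.fiber x := fun x u => ∑ i, u i • s i x
  have hform : ∀ x u (v : Δ.fiber x), g.form x (comb x u) v = ∑ i, u i * g.form x (s i x) v := by
    intro x u v
    simp [comb, map_sum, LinearMap.sum_apply]
  have hdiff : ∀ x ∈ U', ∀ u, differential (n := n) f x (comb x u) = ∑ i, u i * b x i := by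
    intro x hx u
    simp [comb, b, map_sum, hs _ x hx]
  have hspan : ∀ x ∈ U', ∀ v : Δ.fiber x, ∃ u, comb x u = v := by
    intro x hx v
    obtain ⟨u, hu⟩ := (Submodule.mem_span_range_iff_exists_fun ℝ).1 ((he.span_eq x hx).le v.2)
    refine ⟨u, Subtype.ext ?_⟩
    rw [← hu]
    simp [comb, hs _ x hx]
  have hGu : ∀ x u i, (G x).mulVec u i = g.form x (s i x) (comb x u) := by
    intro x u i
    rw [g.symm, hform]
    simp only [Matrix.mulVec, dotProduct, G, Matrix.of_apply]
    exact Finset.sum_congr rfl fun j _ => by rw [mul_comm, g.symm]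
  have hdet : ∀ x ∈ U', (G x).det ≠ 0 := by
    intro x hx h0
    obtain ⟨u, hu, hGu0⟩ := Matrix.exists_mulVec_eq_zero_iff.2 h0
    have hz : g.form x (comb x u) (comb x u) = 0 := by
      rw [hform]
      refine Finset.sum_eq_zero fun i _ => ?_
      rw [← hGu, hGu0]
      simp
    have hc : comb x u = 0 := by
      by_contra hne
      exact (g.pos x _ hne).ne' hz
    apply hu
    funext i
    refine Fintype.linearIndependent_iff.1 (he.linearIndependent x hx) u ?_ i
    have := congrArg Subtype.val hc
    simpa [comb, hs _ x hx] using this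
  -- The maximizer of `p(v) - g(v, v)`, for `p` the differential of `f`, in coordinates.
  let w : M → Fin m → ℝ := fun x => (1 / 2 : ℝ) • (G x)⁻¹.mulVec (b x)
  have hmax : ∀ x ∈ U', ∀ v : Δ.fiber x,
      differential (n := n) f x v = 2 * g.form x (comb x (w x)) v := by
    intro x hx v
    obtain ⟨u, rfl⟩ := hspan x hx v
    have hGw : ∀ i, 2 * g.form x (s i x) (comb x (w x)) = b x i := by
      intro i
      rw [← hGu]
      simp only [w, Matrix.mulVec_smul, Matrix.mulVec_mulVec,
        Matrix.mul_nonsing_inv _ (isUnit_iff_ne_zero.2 (hdet x hx)), Matrix.one_mulVec,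
        Pi.smul_apply, smul_eq_mul]
      ring
    rw [hdiff x hx, g.symm, hform, Finset.mul_sum]
    refine Finset.sum_congr rfl fun i _ => ?_
    rw [← hGw i]
    ring
  have hbc : ContinuousAt b x₀ := continuousAt_pi.2 fun i =>
    continuousAt_differential_apply (hU.inter hU') (hf.mono inter_subset_left)
      ((he.smooth i).mono inter_subset_right) ⟨hx₀, hx₀'⟩
  have hGc : ContinuousAt G x₀ := by
    refine continuousAt_pi.2 fun i => continuousAt_pi.2 fun j => ?_
    exact (g.continuousOn_form hU' (he.smooth i) (heΔ i) (he.smooth j) (heΔ j)).continuousAt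
      (hU'.mem_nhds hx₀')
  have hwc : ContinuousAt w x₀ := continuousAt_inv_mulVec hGc hbc (hdet x₀ hx₀')
  let Q : M → ℝ := fun x => 1 / 2 * ∑ i, w x i * b x i
  have hQc : ContinuousAt Q x₀ := (continuousAt_dotProduct hwc hbc).const_mul _
  have hQ : ∀ x ∈ U', g.form x (comb x (w x)) (comb x (w x)) = Q x := by
    intro x hx
    have := hmax x hx (comb x (w x))
    rw [hdiff x hx] at this
    simp only [Q]
    linarith
  have hQ₀ : Q x₀ < K := by
    have h1 := hK (comb x₀ (w x₀))
    rw [hmax x₀ hx₀', hQ x₀ hx₀'] at h1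
    linarith
  filter_upwards [hU'.mem_nhds hx₀', hQc.eventually (gt_mem_nhds hQ₀)] with x hx hxK v
  have h1 := g.form_self_nonneg x (v - comb x (w x))
  simp only [map_sub, LinearMap.sub_apply] at h1
  have h2 := g.symm x v (comb x (w x))
  have h3 := hQ x hx
  rw [hmax x hx v]
  linarith

variable {g}

/-- A pointwise bound `df ≤ K + c g` integrates along horizontal paths, by the fundamental theorem
of calculus for absolutely continuous functions. -/
theorem Metric.IsHorizontalOn.sub_le {γ : ℝ → M} {a b : ℝ} (hab : a ≤ b)
    (hγ : g.IsHorizontalOn γ a b) {z : M} {W : Set M} (hW : W ⊆ (extChartAt (𝓡 n) z).source)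
    (hmaps : MapsTo γ (Icc a b) W) {f : M → ℝ}
    (hf : ∀ x ∈ W, MDifferentiableAt (𝓡 n) 𝓘(ℝ, ℝ) f x) {L : ℝ≥0}
    (hL : LipschitzOnWith L (fun η => f ((extChartAt (𝓡 n) z).symm η)) (extChartAt (𝓡 n) z '' W))
    {K c E : ℝ} (hc : 0 < c) (hE0 : 0 ≤ E)
    (hpt : ∀ x ∈ W, ∀ v : Δ.fiber x, differential (n := n) f x v ≤ K + c * g.form x v v)
    (hE : g.energyOn γ a b ≤ ENNReal.ofReal E) :
    f (γ b) - f (γ a) ≤ K * (b - a) + c * E := by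
  have hsrc : MapsTo γ (Icc a b) (chartAt (EuclideanSpace ℝ (Fin n)) z).source := fun t ht => by
    have := hW (hmaps ht)
    rwa [extChartAt_source] at this
  have hAC : AbsolutelyContinuousOnInterval (fun t => extChartAt (𝓡 n) z (γ t)) a b :=
    hγ.absolutelyContinuous z a b le_rfl hab le_rfl hsrc
  have hACf : AbsolutelyContinuousOnInterval (fun t => f (γ t)) a b := by
    have h1 := absolutelyContinuousOnInterval_lipschitz_comp hAC hL (by
      intro t ht
      rw [uIcc_of_le hab] at ht
      exact mem_image_of_mem _ (hmaps ht))
    rw [absolutelyContinuousOnInterval_iff] at h1 ⊢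
    intro ε hε
    obtain ⟨δ, hδ, H⟩ := h1 ε hε
    refine ⟨δ, hδ, fun I hI hl => ?_⟩
    have h2 := H I hI hl
    rw [Finset.sum_congr rfl fun i hi => ?_] at h2
    · exact h2
    · have hi' := hI.1 i hi
      rw [uIcc_of_le hab] at hi'
      rw [(extChartAt (𝓡 n) z).left_inv (hW (hmaps hi'.1)),
        (extChartAt (𝓡 n) z).left_inv (hW (hmaps hi'.2))]
  have hderiv : ∀ᵐ t ∂(volume.restrict (Icc a b)),
      HasDerivAt (fun t => f (γ t)) (differential f (γ t) (velocity (n := n) γ t)) t := by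
    rw [← restrict_Ioo_eq_restrict_Icc]
    have h1 := ae_restrict_of_ae (s := Ioo a b)
      (ae_differentiableAt_of_absolutelyContinuousOnInterval hAC)
    filter_upwards [h1, ae_restrict_mem measurableSet_Ioo] with t ht htab
    have htI : t ∈ Icc a b := Ioo_subset_Icc_self htab
    have hd := ht (by rwa [uIcc_of_le hab])
    have hnear : ∀ᶠ s in 𝓝 t, s ∈ Icc a b := Icc_mem_nhds htab.1 htab.2
    have hmd : MDifferentiableAt 𝓘(ℝ, ℝ) (𝓡 n) γ t := by
      have h2 := ((contMDiffAt_extChartAt_symm ((extChartAt (𝓡 n) z).map_source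
        (hW (hmaps htI)))).mdifferentiableAt (by simp)).comp t hd.mdifferentiableAt
      refine h2.congr_of_eventuallyEq ?_
      filter_upwards [hnear] with s hs
      exact ((extChartAt (𝓡 n) z).left_inv (hW (hmaps hs))).symm
    have h3 := (hf _ (hmaps htI)).hasMFDerivAt.comp t hmd.hasMFDerivAt
    let D : ℝ →L[ℝ] ℝ := (mfderiv (𝓡 n) 𝓘(ℝ, ℝ) f (γ t)).comp (mfderiv 𝓘(ℝ, ℝ) (𝓡 n) γ t)
    have h4 : HasFDerivAt (fun t => f (γ t)) D t := hasMFDerivAt_iff_hasFDerivAt.1 h3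
    exact h4.hasDerivAt
  have hint : IntervalIntegrable (deriv fun t => f (γ t)) volume a b :=
    hACf.intervalIntegrable_deriv
  let k : ℝ → ℝ := fun t => (deriv (fun t => f (γ t)) t - K) / c
  have hkint : IntervalIntegrable k volume a b :=
    (hint.sub intervalIntegrable_const).div_const c
  have hkI : IntegrableOn k (Icc a b) :=
    (intervalIntegrable_iff_integrableOn_Icc_of_le hab).1 hkint
  have hle : ∫⁻ t in Icc a b, ENNReal.ofReal (k t) ≤ ENNReal.ofReal E := by
    refine (lintegral_mono_ae ?_).trans hE
    filter_upwards [hderiv, hγ.ae_speed_ne_top, ae_restrict_mem measurableSet_Icc] with t h1 h2 ht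
    have hv := g.cost_ne_top_iff.1 h2
    rw [Metric.speed, g.cost_of_mem hv]
    refine ENNReal.ofReal_le_ofReal ?_
    have h3 := hpt _ (hmaps ht) ⟨_, hv⟩
    simp only [k, h1.deriv]
    rw [div_le_iff₀ hc]
    simp only at h3
    linarith
  have hkE : ∫ t in Icc a b, k t ≤ E := by
    rw [integral_eq_lintegral_pos_part_sub_lintegral_neg_part hkI]
    have h1 : (∫⁻ t in Icc a b, ENNReal.ofReal (k t)).toReal ≤ E :=
      ENNReal.toReal_le_of_le_ofReal hE0 hle
    have h2 : 0 ≤ (∫⁻ t in Icc a b, ENNReal.ofReal (-k t)).toReal := ENNReal.toReal_nonneg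
    linarith
  rw [integral_Icc_eq_integral_Ioc, ← intervalIntegral.integral_of_le hab] at hkE
  have hval : ∫ t in a..b, k t = (f (γ b) - f (γ a) - K * (b - a)) / c := by
    simp only [k]
    rw [intervalIntegral.integral_div, intervalIntegral.integral_sub hint intervalIntegrable_const,
      hACf.integral_deriv_eq_sub, intervalIntegral.integral_const, smul_eq_mul, mul_comm (b - a)]
  rw [hval, div_le_iff₀ hc] at hkE
  linarith

variable (g)

/-- Near `x₀` the increase of a `C¹` function `f` along horizontal paths is controlled by the
duration and the energy. The parameter `c` comes from the homogeneity of the pointwise bound. -/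
theorem Metric.exists_nhds_sub_le {f : M → ℝ} {U : Set M} (hU : IsOpen U)
    (hf : ContMDiffOn (𝓡 n) 𝓘(ℝ, ℝ) 1 f U) {x₀ : M} (hx₀ : x₀ ∈ U) {K : ℝ}
    (hK : 2 * g.hamiltonian x₀ ((1 / 2 : ℝ) • differential f x₀) < K) :
    ∃ V ∈ 𝓝 x₀, ∀ (γ : ℝ → M) (a b c E : ℝ), a ≤ b → g.IsHorizontalOn γ a b →
      MapsTo γ (Icc a b) V → 0 < c → 0 ≤ E → g.energyOn γ a b ≤ ENNReal.ofReal E →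
      f (γ b) - f (γ a) ≤ K / c * (b - a) + c * E := by
  have hpt := g.eventually_differential_le hU hf hx₀ (K := K) fun v =>
    (g.sub_form_le_hamiltonian x₀ _ v).trans_lt hK
  obtain ⟨L, t, ht, hL⟩ := (contDiffAt_comp_extChartAt_symm hU hf
    (mem_chartDomain (mem_extChartAt_source x₀) hx₀)).exists_lipschitzOnWith
  refine ⟨{x | ∀ v : Δ.fiber x, differential (n := n) f x v ≤ K + g.form x v v} ∩
    (U ∩ ((extChartAt (𝓡 n) x₀).source ∩ extChartAt (𝓡 n) x₀ ⁻¹' t)),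
    inter_mem hpt (inter_mem (hU.mem_nhds hx₀) (inter_mem (extChartAt_source_mem_nhds x₀)
      ((continuousAt_extChartAt x₀).preimage_mem_nhds ht))), ?_⟩
  intro γ a b c E hab hγ hm hc hE0 hE
  refine hγ.sub_le hab (fun x hx => hx.2.2.1) hm
    (fun x hx => (hf.contMDiffAt (hU.mem_nhds hx.2.1)).mdifferentiableAt (by simp))
    (hL.mono ?_) hc hE0 (fun x hx v => ?_) hE
  · rintro _ ⟨x, hx, rfl⟩
    exact hx.2.2.2
  · have h1 := hx.1 (c • v)
    simp only [map_smul, LinearMap.smul_apply, Submodule.coe_smul, smul_eq_mul] at h1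
    rw [← mul_le_mul_iff_right₀ hc]
    have : c * (K / c + c * g.form x v v) = K + c * (c * g.form x v v) := by field_simp
    linarith

/-- Horizontal paths of bounded energy ending at `x₀` cannot come from far away in a short time. -/
theorem Metric.exists_forall_mapsTo [T2Space M] {x₀ : M} {N : Set M} (hN : N ∈ 𝓝 x₀) {E : ℝ}
    (hE0 : 0 ≤ E) :
    ∃ h > 0, ∀ (γ : ℝ → M) (a b : ℝ), a ≤ b → b - a < h → g.IsHorizontalOn γ a b → γ b = x₀ →
      g.energyOn γ a b ≤ ENNReal.ofReal E → MapsTo γ (Icc a b) N := by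
  set φ := extChartAt (𝓡 n) x₀ with hφ
  -- Minus the squared distance to `x₀` in the chart.
  let ρ : M → ℝ := fun x => -‖φ x - φ x₀‖ ^ 2
  have hρ : ContMDiffOn (𝓡 n) 𝓘(ℝ, ℝ) 1 ρ φ.source := by
    have h1 : ContDiff ℝ 1 (fun η : EuclideanSpace ℝ (Fin n) => -‖η - φ x₀‖ ^ 2) :=
      ((contDiff_id.sub contDiff_const).norm_sq ℝ).neg
    have h2 : ContMDiffOn (𝓡 n) 𝓘(ℝ, EuclideanSpace ℝ (Fin n)) 1 φ φ.source := by
      rw [hφ, extChartAt_source]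
      exact (contMDiffOn_extChartAt (n := ∞)).of_le (by simp)
    exact h1.contMDiff.comp_contMDiffOn h2
  obtain ⟨V, hV, H⟩ := g.exists_nhds_sub_le (isOpen_extChartAt_source x₀) hρ
    (mem_extChartAt_source x₀) (lt_add_one _)
  set K := 2 * g.hamiltonian x₀ ((1 / 2 : ℝ) • differential ρ x₀) + 1
  have hVN : φ.symm ⁻¹' (V ∩ N) ∈ 𝓝 (φ x₀) := by
    have := continuousAt_extChartAt_symm (I := 𝓡 n) x₀
    refine this.preimage_mem_nhds ?_
    rw [extChartAt_to_inv]
    exact inter_mem hV hN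
  obtain ⟨r, hr, hrsub⟩ := Metric.nhds_basis_closedBall.mem_iff.1
    (inter_mem (extChartAt_target_mem_nhds (I := 𝓡 n) x₀) hVN)
  let Bc : Set M := φ.symm '' Metric.closedBall (φ x₀) r
  let Bo : Set M := φ.source ∩ φ ⁻¹' Metric.ball (φ x₀) r
  have hBo : IsOpen Bo := isOpen_extChartAt_preimage' x₀ Metric.isOpen_ball
  have hBoBc : Bo ⊆ Bc := fun x hx =>
    ⟨φ x, Metric.ball_subset_closedBall hx.2, φ.left_inv hx.1⟩
  have hBcV : Bc ⊆ V ∩ N := by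
    rintro _ ⟨η, hη, rfl⟩
    exact (hrsub hη).2
  have hBcsrc : Bc ⊆ φ.source := by
    rintro _ ⟨η, hη, rfl⟩
    exact φ.map_target (hrsub hη).1
  have hBc : IsClosed Bc := ((isCompact_closedBall (φ x₀) r).image_of_continuousOn
    ((continuousOn_extChartAt_symm x₀).mono fun η hη => (hrsub hη).1)).isClosed
  -- The energy term is made at most `r² / 2` by the choice of `c`, then the other term by that
  -- of `h`.
  let c := r ^ 2 / (2 * (E + 1))
  have hc : 0 < c := by positivity
  have hcE : c * E < r ^ 2 / 2 := by
    have h1 : c * (E + 1) = r ^ 2 / 2 := by simp only [c]; field_simp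
    linarith
  refine ⟨r ^ 2 / 2 / (|K| / c + 1), by positivity, fun γ a b hab hh hγ hb hE => ?_⟩
  suffices hmaps : ∀ t ∈ Icc a b, γ t ∈ Bo from fun t ht => (hBcV (hBoBc (hmaps t ht))).2
  by_contra hcon
  push Not at hcon
  obtain ⟨t₀, ht₀, hγt₀⟩ := hcon
  -- The last time outside the open ball.
  have hcl : IsCompact (Icc a b ∩ γ ⁻¹' Boᶜ) :=
    isCompact_Icc.of_isClosed_subset
      (hγ.continuousOn.preimage_isClosed_of_isClosed isClosed_Icc hBo.isClosed_compl)
      inter_subset_left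
  obtain ⟨s, ⟨hs, hγs⟩, hsmax⟩ := hcl.exists_isGreatest ⟨t₀, ht₀, hγt₀⟩
  have hafter : ∀ t ∈ Ioc s b, γ t ∈ Bc := fun t ht => hBoBc (by
    by_contra hne
    exact absurd (hsmax ⟨⟨hs.1.trans ht.1.le, ht.2⟩, hne⟩) (not_le.2 ht.1))
  have hx₀Bo : x₀ ∈ Bo := ⟨mem_extChartAt_source x₀, Metric.mem_ball_self hr⟩
  have hsb : s < b := by
    refine hs.2.lt_of_ne fun h => hγs ?_
    rw [h, hb]
    exact hx₀Bo
  have hγsBc : γ s ∈ Bc := by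
    have hcont : ContinuousWithinAt γ (Ioc s b) s :=
      (hγ.continuousOn s hs).mono fun t ht => ⟨hs.1.trans ht.1.le, ht.2⟩
    have : (𝓝[Ioc s b] s).NeBot := left_nhdsWithin_Ioc_neBot hsb
    exact hBc.mem_of_tendsto hcont (eventually_mem_nhdsWithin.mono hafter)
  have hmapsV : MapsTo γ (Icc s b) V := fun t ht => by
    rcases ht.1.eq_or_lt with rfl | hlt
    · exact (hBcV hγsBc).1
    · exact (hBcV (hafter t ⟨hlt, ht.2⟩)).1
  have hEs : g.energyOn γ s b ≤ ENNReal.ofReal E :=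
    (lintegral_mono_set (Icc_subset_Icc_left hs.1)).trans hE
  have h1 := H γ s b c E hsb.le (hγ.mono hs.1 le_rfl) hmapsV hc hE0 hEs
  have h2 : r ^ 2 ≤ ‖φ (γ s) - φ x₀‖ ^ 2 := by
    have : ¬ ‖φ (γ s) - φ x₀‖ < r := fun hlt => hγs ⟨hBcsrc hγsBc, by
      rw [mem_preimage, Metric.mem_ball, dist_eq_norm]
      exact hlt⟩
    have := not_lt.1 this
    gcongr
  have h3 : K / c * (b - s) ≤ r ^ 2 / 2 := by
    rw [lt_div_iff₀ (by positivity)] at hh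
    have h4 : K / c * (b - s) ≤ |K| / c * (b - s) := by
      have := sub_nonneg.2 hsb.le
      gcongr
      exact le_abs_self K
    have h5 : |K| / c * (b - s) ≤ |K| / c * (b - a) := by
      have := hs.1
      gcongr
    nlinarith
  simp only [ρ, hb, sub_self, norm_zero] at h1
  linarith

end Growth

/-! ### The Hamilton–Jacobi equation -/

section Viscosity

variable {n m : ℕ} {M : Type*} [TopologicalSpace M]
  [ChartedSpace (EuclideanSpace ℝ (Fin n)) M] [IsManifold (𝓡 n) ∞ M]
  {Δ : Distribution n m M} (g : Metric Δ)

/-- A vector of `Δ` is the value of a local smooth section of `Δ`. -/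
theorem Distribution.exists_section (Δ : Distribution n m M) {x₀ : M} (v : Δ.fiber x₀) :
    ∃ U : Set M, IsOpen U ∧ x₀ ∈ U ∧ ∃ X : ∀ y : M, TangentSpace (𝓡 n) y,
      SmoothVectorFieldOn X U ∧ (∀ y ∈ U, X y ∈ Δ.fiber y) ∧ X x₀ = v := by
  obtain ⟨U, hU, hx₀, e, he⟩ := Δ.exists_represents x₀
  obtain ⟨u, hu⟩ := (Submodule.mem_span_range_iff_exists_fun ℝ).1 ((he.span_eq x₀ hx₀).le v.2)
  refine ⟨U, hU, hx₀, fun y => ∑ i, u i • e i y, ?_, fun y hy => ?_, hu⟩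
  · exact ContMDiffOn.sum_section fun i _ => ContMDiffOn.const_smul_section (he.smooth i)
  · rw [he.span_eq y hy]
    exact Submodule.sum_mem _ fun i _ =>
      Submodule.smul_mem _ _ (Submodule.subset_span (mem_range_self i))

/-- Following a section of `Δ` backwards from `x₀` for a short time `h` and coming back to `x₀` at
unit speed bounds `V(x₀)` by values of `V`, hence of a test function, near `x₀`. -/
theorem Metric.differential_sub_form_le_value [T1Space M] {xbar x₀ : M}
    (hfin : ∀ x, g.eValue xbar x ≠ ⊤) (hx₀ : x₀ ≠ xbar) {f : M → ℝ}
    (hf : ContMDiffOn (𝓡 n) 𝓘(ℝ, ℝ) 1 f {xbar}ᶜ)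
    (hle : ∀ x ∈ ({xbar}ᶜ : Set M), g.value xbar x ≤ f x) (heq : f x₀ = g.value xbar x₀)
    (v : Δ.fiber x₀) :
    differential (n := n) f x₀ v - g.form x₀ v v ≤ g.value xbar x₀ := by
  obtain ⟨U, hU, hx₀U, X, hX, hXΔ, hXv⟩ := Δ.exists_section v
  obtain ⟨Φ, -, hΦ0, hΦd, hΦE⟩ :=
    g.exists_horizontal_flow (mem_extChartAt_source (I := 𝓡 n) x₀) hU hx₀U hX hXΔ
  set ξ := extChartAt (𝓡 n) x₀ x₀ with hξ
  have hsec : Δ.toSection X x₀ = v :=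
    Subtype.ext ((Distribution.coe_toSection (hXΔ x₀ hx₀U)).trans hXv)
  rw [hsec] at hΦE
  let y : ℝ → M := fun τ => (extChartAt (𝓡 n) x₀).symm (Φ (ξ, τ))
  have hy0 : y 0 = x₀ := by
    simp only [y]
    rw [hΦ0]
    exact extChartAt_to_inv x₀
  have hUc : IsOpen ({xbar}ᶜ : Set M) := isOpen_compl_singleton
  have hmem : ξ ∈ chartDomain n x₀ {xbar}ᶜ := mem_chartDomain (mem_extChartAt_source x₀) hx₀
  -- The derivative of `f` along the curve `y` at time `0`.
  have hderiv : HasDerivAt (fun τ => f (y τ)) (differential (n := n) f x₀ v) 0 := by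
    have h1 : HasDerivAt (fun τ : ℝ => Φ (ξ, τ)) (chartField x₀ X ξ) 0 := by
      have hι : HasDerivAt (fun τ : ℝ => (ξ, τ)) (0, 1) 0 :=
        (hasDerivAt_const (0 : ℝ) ξ).prodMk (hasDerivAt_id (0 : ℝ))
      refine (hΦd.comp_hasDerivAt (0 : ℝ) hι).congr_deriv ?_
      change (0 : EuclideanSpace ℝ (Fin n)) + (1 : ℝ) • chartField x₀ X ξ = _
      rw [zero_add, one_smul]
    have h2 : MDifferentiableAt (𝓡 n) 𝓘(ℝ, ℝ) f ((extChartAt (𝓡 n) x₀).symm ξ) :=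
      (hf.contMDiffAt (hUc.mem_nhds hmem.2)).mdifferentiableAt (by simp)
    have h3 := h2.hasMFDerivAt.comp ξ
      ((contMDiffAt_extChartAt_symm hmem.1).mdifferentiableAt (by simp)).hasMFDerivAt
    let A : EuclideanSpace ℝ (Fin n) →L[ℝ] ℝ :=
      differential f ((extChartAt (𝓡 n) x₀).symm ξ)
    let B : EuclideanSpace ℝ (Fin n) →L[ℝ] EuclideanSpace ℝ (Fin n) :=
      mfderiv 𝓘(ℝ, EuclideanSpace ℝ (Fin n)) (𝓡 n) (extChartAt (𝓡 n) x₀).symm ξ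
    have h4 : HasFDerivAt (fun η => f ((extChartAt (𝓡 n) x₀).symm η)) (A.comp B) ξ :=
      hasMFDerivAt_iff_hasFDerivAt.1 h3
    have h5 := HasFDerivAt.comp_hasDerivAt (0 : ℝ) (by rw [hΦ0]; exact h4) h1
    have h6 : (A.comp B) (chartField x₀ X ξ) = differential (n := n) f x₀ v := by
      have h7 : B (chartField x₀ X ξ) = X ((extChartAt (𝓡 n) x₀).symm ξ) :=
        mfderiv_chartField hmem.1 X
      rw [ContinuousLinearMap.comp_apply, h7]
      have h8 : ∀ x, x = x₀ → (differential (n := n) f x (X x) : ℝ)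
          = differential (n := n) f x₀ (X x₀) := by rintro x rfl; rfl
      rw [← hXv]
      exact h8 _ (extChartAt_to_inv x₀)
    rw [h6] at h5
    exact h5
  refine le_of_forall_pos_le_add fun δ hδ => ?_
  set C := g.form x₀ v v + δ with hC
  have hCE := hΦE C (by linarith)
  set V₀ := g.value xbar x₀ with hV₀
  have hCpos : 0 < C := by have := g.form_self_nonneg x₀ v; linarith
  have hneg : Tendsto (fun h : ℝ => -h) (𝓝[>] 0) (𝓝 0) := by
    have : Tendsto (fun h : ℝ => -h) (𝓝 0) (𝓝 (-0)) := continuous_neg.continuousAt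
    rw [neg_zero] at this
    exact this.mono_left nhdsWithin_le_nhds
  have hι : Tendsto (fun h : ℝ => (ξ, -h)) (𝓝[>] 0) (𝓝 (ξ, 0)) :=
    (tendsto_const_nhds (x := ξ)).prodMk_nhds hneg
  have hyc : ContinuousAt y 0 := by
    have h1 : ContinuousAt (fun τ : ℝ => Φ (ξ, τ)) 0 :=
      ContinuousAt.comp (g := Φ) hΦd.continuousAt (by fun_prop)
    refine ContinuousAt.comp (g := (extChartAt (𝓡 n) x₀).symm) ?_ h1
    rw [hΦ0]
    exact (contMDiffAt_extChartAt_symm hmem.1).continuousAt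
  have hyU : ∀ᶠ h in 𝓝[>] (0 : ℝ), y (-h) ∈ ({xbar}ᶜ : Set M) :=
    hneg.eventually (hyc.eventually (hUc.mem_nhds (by rw [hy0]; exact hx₀)))
  have hineq : ∀ᶠ h in 𝓝[>] (0 : ℝ),
      (f (y (-h)) - V₀) / (-h) - h ≤ V₀ + (C + h) * (1 - h) := by
    have hlt1 : ∀ᶠ h in 𝓝[>] (0 : ℝ), h < 1 :=
      nhdsWithin_le_nhds (gt_mem_nhds one_pos)
    filter_upwards [hι.eventually hCE, hyU, hlt1, self_mem_nhdsWithin] with h h1 h2 h3 h4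
    have hpos : 0 < h := h4
    have e1 : g.eValue xbar (y (-h)) < ENNReal.ofReal (f (y (-h)) + h ^ 2) := by
      rw [Metric.eValue_lt_ofReal_iff (hfin _)]
      have := hle _ h2
      have : 0 < h ^ 2 := by positivity
      linarith
    have e2 : g.eValue (y (-h)) x₀ < ENNReal.ofReal ((C + h) * h ^ 2) := by
      rw [g.eValue_comm]
      have h5 : g.eValue x₀ (y (-h)) ≤ ENNReal.ofReal (C * (-h) ^ 2) := by
        have h6 : (extChartAt (𝓡 n) x₀).symm ξ = x₀ := extChartAt_to_inv x₀
        simpa only [h6] using h1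
      refine h5.trans_lt ((ENNReal.ofReal_lt_ofReal_iff (by positivity)).2 ?_)
      rw [neg_sq]
      gcongr
      linarith
    have e3 := g.eValue_triangle (s := 1 - h) (by linarith) (by linarith) e1 e2
    rw [Metric.eValue_lt_ofReal_iff (hfin _), ← hV₀] at e3
    have e4 : (C + h) * h ^ 2 / (1 - (1 - h)) = (C + h) * h := by
      rw [sub_sub_cancel]; field_simp
    have e5 : V₀ - (C + h) * h < (f (y (-h)) + h ^ 2) / (1 - h) := by
      rw [e4] at e3; linarith
    rw [lt_div_iff₀ (by linarith)] at e5
    have e6 : (f (y (-h)) - V₀) / (-h) = -((f (y (-h)) - V₀) / h) := by rw [div_neg]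
    have e7 : -(V₀ + (C + h) * (1 - h) + h) ≤ (f (y (-h)) - V₀) / h := by
      rw [le_div_iff₀ hpos]
      nlinarith
    linarith
  have hlim1 : Tendsto (fun h : ℝ => (f (y (-h)) - V₀) / (-h) - h) (𝓝[>] 0)
      (𝓝 (differential (n := n) f x₀ v - 0)) := by
    have h1 := (hasDerivAt_iff_tendsto_slope_zero.1 hderiv).comp (x := 𝓝[>] (0 : ℝ))
      (f := fun h : ℝ => -h) (tendsto_nhdsWithin_iff.2 ⟨hneg, by
        filter_upwards [self_mem_nhdsWithin] with h hh
        have : (0 : ℝ) < h := hh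
        simpa using this.ne'⟩)
    refine (h1.congr fun h => ?_).sub (tendsto_id.mono_left nhdsWithin_le_nhds)
    simp only [Function.comp, zero_add, hy0, heq, smul_eq_mul]
    rw [div_eq_inv_mul]
  have hlim2 : Tendsto (fun h : ℝ => V₀ + (C + h) * (1 - h)) (𝓝[>] 0)
      (𝓝 (V₀ + (C + 0) * (1 - 0))) := by
    have : Continuous fun h : ℝ => V₀ + (C + h) * (1 - h) := by fun_prop
    exact (this.tendsto 0).mono_left nhdsWithin_le_nhds
  have := le_of_tendsto_of_tendsto hlim1 hlim2 hineq
  rw [sub_zero, add_zero, sub_zero, mul_one] at this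
  linarith

/-- Cutting an almost minimizing path shortly before its end bounds `V` near `x₀` by the
Hamiltonian. No minimizing path is needed. -/
theorem Metric.value_le_hamiltonian [T2Space M] {xbar x₀ : M}
    (hfin : ∀ x, g.eValue xbar x ≠ ⊤) (hcont : ContinuousAt (g.value xbar) x₀) (hx₀ : x₀ ≠ xbar)
    {f : M → ℝ} (hf : ContMDiffOn (𝓡 n) 𝓘(ℝ, ℝ) 1 f {xbar}ᶜ)
    (hle : ∀ x ∈ ({xbar}ᶜ : Set M), f x ≤ g.value xbar x) (heq : f x₀ = g.value xbar x₀) :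
    g.value xbar x₀ ≤ 2 * g.hamiltonian x₀ ((1 / 2 : ℝ) • differential f x₀) := by
  have hUc : IsOpen ({xbar}ᶜ : Set M) := isOpen_compl_singleton
  set V₀ := g.value xbar x₀ with hV₀
  have hV₀0 : 0 ≤ V₀ := g.value_nonneg _ _
  refine le_of_forall_pos_le_add fun δ hδ => ?_
  set K := 2 * g.hamiltonian x₀ ((1 / 2 : ℝ) • differential f x₀) + δ / 3 with hK
  obtain ⟨W, hW, H⟩ := g.exists_nhds_sub_le hUc hf hx₀ (K := K) (by linarith)
  have hN : W ∩ {xbar}ᶜ ∩ {x | V₀ - δ / 3 < g.value xbar x} ∈ 𝓝 x₀ :=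
    inter_mem (inter_mem hW (hUc.mem_nhds hx₀))
      (hcont.eventually (lt_mem_nhds (show V₀ - δ / 3 < g.value xbar x₀ by linarith)))
  obtain ⟨h₀, hh₀, Hmaps⟩ := g.exists_forall_mapsTo hN (E := V₀ + 1) (by linarith)
  -- The duration of the last piece.
  set h := min (h₀ / 2) (min (1 / 2) (δ / 3)) with hh
  have hpos : 0 < h := by positivity
  have hlt0 : h < h₀ := (min_le_left _ _).trans_lt (by linarith)
  have hle2 : h ≤ 1 / 2 := (min_le_right _ _).trans (min_le_left _ _)
  have hle3 : h ≤ δ / 3 := (min_le_right _ _).trans (min_le_right _ _)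
  have hs : 0 < 1 - h := by linarith
  have hVlt : g.eValue xbar x₀ < ENNReal.ofReal (V₀ + h ^ 2) := by
    rw [Metric.eValue_lt_ofReal_iff (hfin _)]
    have : 0 < h ^ 2 := by positivity
    linarith
  obtain ⟨γ, hγ, hγ0, hγ1, hE⟩ := g.eValue_lt_iff.1 hVlt
  rw [← Metric.energyOn_add γ hs.le (by linarith : 1 - h ≤ 1)] at hE
  have hE₁top : g.energyOn γ 0 (1 - h) ≠ ⊤ :=
    ne_top_of_le_ne_top hE.ne_top le_self_add
  have hE₂top : g.energyOn γ (1 - h) 1 ≠ ⊤ :=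
    ne_top_of_le_ne_top hE.ne_top le_add_self
  set E₁ := (g.energyOn γ 0 (1 - h)).toReal with hE₁
  set E₂ := (g.energyOn γ (1 - h) 1).toReal with hE₂
  have hsum : E₁ + E₂ < V₀ + h ^ 2 := by
    rw [hE₁, hE₂, ← ENNReal.toReal_add hE₁top hE₂top]
    exact (ENNReal.lt_ofReal_iff_toReal_lt (ENNReal.add_ne_top.2 ⟨hE₁top, hE₂top⟩)).1 hE
  have hE₁0 : 0 ≤ E₁ := ENNReal.toReal_nonneg
  have hE₂0 : 0 ≤ E₂ := ENNReal.toReal_nonneg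
  have hE₂le : g.energyOn γ (1 - h) 1 ≤ ENNReal.ofReal E₂ := (ENNReal.ofReal_toReal hE₂top).ge
  have hγlast := hγ.mono hs.le (le_refl (1 : ℝ))
  have hmaps := Hmaps γ (1 - h) 1 (by linarith) (by linarith) hγlast hγ1
    (hE₂le.trans (ENNReal.ofReal_le_ofReal (by nlinarith)))
  have hy := hmaps (left_mem_Icc.2 (by linarith))
  have hgrow := H γ (1 - h) 1 1 E₂ (by linarith) hγlast (fun t ht => (hmaps ht).1.1) one_pos hE₂0
    hE₂le
  rw [hγ1, heq, div_one, one_mul, sub_sub_cancel] at hgrow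
  have hVy : g.value xbar (γ (1 - h)) ≤ (1 - h) * E₁ := by
    have h1 := Metric.eValue_le_of_isHorizontalOn hs (hγ.mono le_rfl (by linarith : 1 - h ≤ 1))
    rw [hγ0, ← ENNReal.ofReal_toReal hE₁top, ← ENNReal.ofReal_mul hs.le] at h1
    exact ENNReal.toReal_le_of_le_ofReal (by positivity) h1
  have hfy := hle _ hy.1.2
  have hnear : V₀ - δ / 3 < g.value xbar (γ (1 - h)) := hy.2
  -- `V(y) ≤ (1 - h) E₁` and `V(y) ≥ f(y) ≥ E₁ - K h - h²` together give `V(y) ≤ K + h`.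
  have hmain : g.value xbar (γ (1 - h)) * h ≤ (K + h) * h * (1 - h) := by
    nlinarith
  have hE₁K : E₁ ≤ K + h := by
    have : E₁ * h ≤ (K + h) * h := by nlinarith
    exact le_of_mul_le_mul_right this hpos
  nlinarith

end Viscosity

end SubRiemannian

end

theorem mainTheorem5 {n m : ℕ} {M : Type*} [TopologicalSpace M] [T2Space M]
    [SecondCountableTopology M] [ConnectedSpace M]
    [ChartedSpace (EuclideanSpace ℝ (Fin n)) M] [IsManifold (𝓡 n) ∞ M]
    (Δ : SubRiemannian.Distribution n m M) (g : SubRiemannian.Metric Δ) (xbar : M)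
    (hΔ : Δ.IsNonholonomic) :
    (∀ x : M, g.eValue xbar x ≠ ⊤) ∧
      Continuous (g.value xbar) ∧
      SubRiemannian.IsViscositySolution
        (fun x p u => -(1 / 2) * u + g.hamiltonian x ((1 / 2 : ℝ) • p))
        (g.value xbar) {xbar}ᶜ := by
  have hfin := g.eValue_ne_top hΔ xbar
  have hcont := g.continuous_value hΔ xbar
  refine ⟨hfin, hcont, ⟨hcont.continuousOn, fun φ hφ hle x₀ hx₀ heq => ?_⟩,
    ⟨hcont.continuousOn, fun ψ hψ hle x₀ hx₀ heq => ?_⟩⟩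
  · obtain ⟨v, hv⟩ := (g.isGreatest_hamiltonian x₀
      ((1 / 2 : ℝ) • SubRiemannian.differential φ x₀)).1
    have h := g.differential_sub_form_le_value hfin hx₀ hφ hle heq v
    simp only [smul_apply, smul_eq_mul] at hv
    linarith
  · have h := g.value_le_hamiltonian hfin hcont.continuousAt hx₀ hψ hle heq
    linarith
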